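/- **Setting.** Let $\bar\alpha$ be a finite poset with $n$ elements, let $x_1<\dots<x_k$ be a chain in $\bar\alpha$, and let $\alpha=\{y_1,\dots,y_{n-k}\}$ be the set of the remaining elements. Let $x_0$ and $x_{k+1}$ be additional elements, smaller respectively bigger than all elements of $\bar\alpha$ (they are counted in the sets of elements between chain elements below). Let $i_1<\dots<i_k$ be in $\{1,\dots,n\}$, $i_0:=0$, $i_{k+1}:=n+1$, and let $\ell\in\{1,\dots,k\}$ satisfy $i_{\ell-1}+1<i_\ell<i_{\ell+1}-1$. Let $\mathcal N_-,\mathcal N_=,\mathcal N_+$ be the sets of linear extensions (order preserving bijections) $\sigma:\bar\alpha\to\{1,\dots,n\}$ with $\sigma(x_m)=i_m$ for all $m\in\{1,\dots,k\}\setminus\{\ell\}$ and with $\sigma(x_\ell)=i_\ell-1$, $i_\ell$, $i_\ell+1$, respectively. For $0\le m\le k$ let $K_m\subset\mathbb R^{n-k}$ be the polytope of all $t\in[0,1]^{n-k}$ such that $t_u\le t_v$ whenever $y_u\le y_v$, $t_j=0$ whenever $y_j<x_m$, and $t_j=1$ whenever $y_j>x_{m+1}$. Let $\mathcal K$ be the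 collection consisting of $i_{m+1}-i_m-1-\mathbf 1_{\{m\in\{\ell-1,\ell\}\}}$ copies of $K_m$ for each $0\le m\le k$, and let $\mathcal K_m$ be the collection of $i_{m+1}-i_m-1$ copies of $K_m$. For a polytope $C$ and a unit vector $\mathrm u$ write $F(C,\mathrm u)=\{x\in C:\langle \mathrm u,x\rangle=\sup_{z\in C}\langle\mathrm u,z\rangle\}$. A unit vector $\mathrm u\in\mathbb R^{n-k}$ is a *$(B,\mathcal K)$-extreme normal direction* if $\dim\big(\sum_{K\in\mathcal K'}F(K,\mathrm u)\big)\ge|\mathcal K'|$ for every subcollection $\mathcal K'\subseteq\mathcal K$ (copies are counted with multiplicity). Let $e_1,\dots,e_{n-k}$ be the standard basis of $\mathbb R^{n-k}$ and $e_{uv}:=(e_u-e_v)/\sqrt2$. A pair of integers $(r,s)$ is *splitting* if $0\le r+1<s\le k+1$ and $(r+1,s)\ne(0,k+1)$; it is *$\ell$-splitting* if moreover $r+1<\ell<s$. An $\ell$-splitting pair is *sharp-critical* if $\mathcal K':=(\mathcal K_0,\dots,\mathcal K_r,\mathcal K_s,\dots,\mathcal K_k)$ satisfies $\dim\big(\sum_{K\in\mathcal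 K'}K\big)=|\mathcal K'|+1$. If there is a sharp-critical $\ell$-splitting pair, let $r_{\max}$ be the largest $r$ and $s_{\min}$ the smallest $s$ among all sharp-critical $\ell$-splitting pairs $(r,s)$. **Assumptions.** $\mathcal K$ is critical, i.e. $\dim\big(\sum_{K\in\mathcal K'}K\big)\ge|\mathcal K'|+1$ for every nonempty subcollection $\mathcal K'\subseteq\mathcal K$; and $|\{z: x_{r+1}\le z\le x_s\}|\le i_s-i_{r+1}$ for every splitting pair $(r,s)$. **Proposition.** The following vectors are $(B,\mathcal K)$-extreme normal directions: (a) for each $0\le m\le\ell$: $-e_j$ for any $j$ such that $y_j>x_m$ and there exists $\sigma\in\mathcal N_=$ with $\sigma(y_j)=i_m+1$; (b) for each $\ell\le m\le k+1$: $e_j$ for any $j$ such that $y_j<x_m$ and there exists $\sigma\in\mathcal N_=$ with $\sigma(y_j)=i_m-1$; (c) $e_{uv}$ for any $u,v$ such that $y_u<y_v$ and there exists $\sigma\in\mathcal N_=$ with $\sigma(y_u)+1=\sigma(y_v)$; (d) $e_{uv}$ for any $u,v$ such that $y_u<y_v$ and there exists $\sigma\in\mathcal N_=$ with $\sigma(y_u)=i_\ell-1$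 and $\sigma(y_v)=i_\ell+1$; (e) if there is a sharp-critical $\ell$-splitting pair, for each $r_{\max}+1\le m\le\ell-1$: $-e_j$ for any $j$ such that $y_j>x_m$ and there exists $\sigma\in\mathcal N_=$ with $\sigma(y_j)=i_m+2$; (f) if there is a sharp-critical $\ell$-splitting pair, for each $\ell+1\le m\le s_{\min}$: $e_j$ for any $j$ such that $y_j<x_m$ and there exists $\sigma\in\mathcal N_=$ with $\sigma(y_j)=i_m-2$; (g) $-e_j$ for any $j$ such that $y_j>x_{\ell-1}$ and there exists $\sigma\in\mathcal N_+$ with $\sigma(y_j)=i_{\ell-1}+2$; (h) $e_j$ for any $j$ such that $y_j<x_{\ell+1}$ and there exists $\sigma\in\mathcal N_-$ with $\sigma(y_j)=i_{\ell+1}-2$. -/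

import Mathlib

open scoped Pointwise

noncomputable section

namespace Stanley

section Convex

variable {E : Type*} [NormedAddCommGroup E] [InnerProductSpace ℝ E]

/-- The support function `h_C(u) = sup_{x ∈ C} ⟨u, x⟩`. -/
def supportFun (C : Set E) (u : E) : ℝ :=
  sSup ((fun x : E => inner ℝ u x) '' C)

/-- The face `F(C, u) = {x ∈ C : ⟨u, x⟩ = h_C(u)}`. -/
def face (C : Set E) (u : E) : Set E :=
  {x | x ∈ C ∧ inner ℝ u x = supportFun C u}

/-- The dimension of a nonempty convex set: the dimension of its affine hull. -/
def dim (C : Set E) : ℕ :=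
  Module.finrank ℝ (vectorSpan ℝ C)

/-- `u` is a `(B, 𝒞)`-extreme normal direction (`B` the unit ball) of the finite collection
`𝒞 = (C j)_j`. Collections may contain the same body several times, so that a subcollection
is a set of indices; the sum is the Minkowski sum. -/
def IsExtremeNormalDirection {ι : Type*} (C : ι → Set E) (u : E) : Prop :=
  ‖u‖ = 1 ∧ ∀ S : Finset ι, S.card ≤ dim (∑ j ∈ S, face (C j) u)

/-- The collection `𝒞 = (C j)_j` is critical. -/
def IsCritical {ι : Type*} (C : ι → Set E) : Prop :=
  ∀ S : Finset ι, S.Nonempty → S.card + 1 ≤ dim (∑ j ∈ S, C j)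

end Convex

/-- A finite poset `P` with a chain `x_1 < ⋯ < x_k`, positions `i_1 < ⋯ < i_k` in
`{1, …, n}`, where `n = |P|`, extended by `i_0 = 0` and `i_{k+1} = n + 1`, and an index
`ℓ ∈ {1, …, k}` with `i_{ℓ-1} + 1 < i_ℓ < i_{ℓ+1} - 1`.
The element `x_m` of the chain is `x ⟨m - 1, _⟩`; only the values `i 0, …, i (k + 1)` matter. -/
structure ChainData (P : Type*) [PartialOrder P] [Fintype P] where
  k : ℕ
  x : Fin k → P
  x_strictMono : StrictMono x
  i : ℕ → ℕ
  i_zero : i 0 = 0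
  i_last : i (k + 1) = Fintype.card P + 1
  i_lt : ∀ m, m ≤ k → i m < i (m + 1)
  l : ℕ
  one_le_l : 1 ≤ l
  l_le_k : l ≤ k
  gap_left : i (l - 1) + 1 < i l
  gap_right : i l + 1 < i (l + 1)

/-- `P` with a new least element and a new greatest element. -/
abbrev Ext (P : Type*) : Type _ := WithBot (WithTop P)

/-- The inclusion of `P` into the extended poset. -/
def toExt {P : Type*} (z : P) : Ext P := ((z : WithTop P) : WithBot (WithTop P))

namespace ChainData

variable {P : Type*} [PartialOrder P] [Fintype P] (D : ChainData P)

/-- The chain `x_0 < x_1 < ⋯ < x_{k+1}` in the extended poset, where `x_0` is the new least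
and `x_{k+1}` the new greatest element. -/
def chain (m : ℕ) : Ext P :=
  if m = 0 then ⊥
  else if h : m - 1 < D.k then toExt (D.x ⟨m - 1, h⟩)
  else ⊤

/-- The set `α = {y_1, …, y_{n-k}}` of the elements outside the chain. -/
def Alpha : Type _ := {z : P // z ∉ Set.range D.x}

instance : Fintype D.Alpha := by
  classical
  exact inferInstanceAs (Fintype {z : P // z ∉ Set.range D.x})

/-- The underlying element of the poset. -/
def val (y : D.Alpha) : P := Subtype.val y

/-- The Euclidean space `ℝ^{n-k}`, with coordinates indexed by `α`. -/
abbrev Space : Type _ := EuclideanSpace ℝ D.Alpha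

open scoped Classical in
/-- The standard basis vector `e_j` for `y_j ∈ α`. -/
def e (y : D.Alpha) : D.Space := EuclideanSpace.single y (1 : ℝ)

/-- The vector `e_{uv} = (e_u - e_v) / √2`. -/
def e₂ (u v : D.Alpha) : D.Space := (Real.sqrt 2)⁻¹ • (D.e u - D.e v)

/-- Linear extensions of `P`: order preserving bijections from `P` onto `{1, …, n}`. -/
def IsLinearExtension (σ : P → ℕ) : Prop :=
  Set.BijOn σ Set.univ (Set.Icc 1 (Fintype.card P)) ∧ ∀ w z : P, w ≤ z → σ w ≤ σ z

/-- The linear extensions with `σ(x_ℓ) = p` and `σ(x_m) = i_m` for all other `m ∈ {1, …, k}`. -/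
def extensionsAt (p : ℕ) : Set (P → ℕ) :=
  {σ | IsLinearExtension σ ∧
    ∀ m : Fin D.k, σ (D.x m) = if (m : ℕ) + 1 = D.l then p else D.i ((m : ℕ) + 1)}

/-- `𝒩₋` -/
def Nminus : Set (P → ℕ) := D.extensionsAt (D.i D.l - 1)

/-- `𝒩₌` -/
def Neq : Set (P → ℕ) := D.extensionsAt (D.i D.l)

/-- `𝒩₊` -/
def Nplus : Set (P → ℕ) := D.extensionsAt (D.i D.l + 1)

/-- The order polytope of `α`. -/
def orderPolytope : Set D.Space :=
  {t | (∀ y, 0 ≤ t y ∧ t y ≤ 1) ∧ ∀ u v, D.val u ≤ D.val v → t u ≤ t v}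

/-- The polytope `K_m`, for `0 ≤ m ≤ k`: the points `t` of the order polytope with `t_j = 0`
if `y_j < x_m` and `t_j = 1` if `y_j > x_{m+1}`. -/
def K (m : ℕ) : Set D.Space :=
  {t | t ∈ D.orderPolytope ∧ ∀ y : D.Alpha,
    (toExt (D.val y) < D.chain m → t y = 0) ∧ (D.chain (m + 1) < toExt (D.val y) → t y = 1)}

/-- The number of copies of `K_m` in the collection `𝒦`. -/
def mult (m : ℕ) : ℕ :=
  D.i (m + 1) - D.i m - 1 - if m + 1 = D.l ∨ m = D.l then 1 else 0

/-- The indices of the collection `𝒦`: pairs of some `m ∈ {0, …, k}` and the number of a copy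
of `K_m`. -/
abbrev Index : Type := Σ m : Fin (D.k + 1), Fin (D.mult m)

/-- The collection `𝒦`, with `i_{m+1} - i_m - 1` copies of `K_m` for `m ∉ {ℓ-1, ℓ}` and
`i_{m+1} - i_m - 2` copies of `K_m` for `m ∈ {ℓ-1, ℓ}`. -/
def collection (j : D.Index) : Set D.Space := D.K (j.1 : ℕ)

/-- `(r, s)` is a splitting pair. As `r ≥ -1`, pairs are given through `a = r + 1` and `s`. -/
def IsSplittingPair (a s : ℕ) : Prop :=
  a < s ∧ s ≤ D.k + 1 ∧ (a, s) ≠ (0, D.k + 1)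

/-- `(r, s)`, with `r = a - 1`, is an `ℓ`-splitting pair. -/
def IsLSplittingPair (a s : ℕ) : Prop :=
  D.IsSplittingPair a s ∧ a < D.l ∧ D.l < s

/-- The indices of the subcollection `(𝒦_0, …, 𝒦_r, 𝒦_s, …, 𝒦_k)` of `𝒦`, where `r = a - 1` and
`𝒦_m` consists of `i_{m+1} - i_m - 1` copies of `K_m`. (It is used for `a < ℓ < s`, so that
`m ∉ {ℓ-1, ℓ}` for each occurring `𝒦_m` and all copies are in `𝒦`.) -/
def outer (a s : ℕ) : Finset D.Index :=
  Finset.univ.filter fun j => (j.1 : ℕ) < a ∨ s ≤ (j.1 : ℕ)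

/-- `(r, s)`, with `r = a - 1`, is a sharp-critical `ℓ`-splitting pair. -/
def IsSharpCriticalPair (a s : ℕ) : Prop :=
  D.IsLSplittingPair a s ∧
    dim (∑ j ∈ D.outer a s, D.collection j) = (D.outer a s).card + 1

/-- `(r, s)`, with `r = a - 1`, is the maximal splitting pair `(r_max, s_min)`: `r_max` is the
maximum of the `r`, and `s_min` the minimum of the `s`, over all sharp-critical `ℓ`-splitting
pairs. There is no such pair if there is no sharp-critical `ℓ`-splitting pair. -/
def IsMaximalSplittingPair (a s : ℕ) : Prop :=
  IsGreatest {a' | ∃ s', D.IsSharpCriticalPair a' s'} a ∧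
    IsLeast {s' | ∃ a', D.IsSharpCriticalPair a' s'} s

/-- For every splitting pair `(r, s)`, the number of the elements `z` of the extended poset with
`x_{r+1} ≤ z ≤ x_s` is at most `i_s - i_{r+1}`. -/
def SplittingBound : Prop :=
  ∀ a s, D.IsSplittingPair a s →
    (Set.Icc (D.chain a) (D.chain s)).ncard ≤ D.i s - D.i a

end ChainData

end Stanley

end

namespace Stanley

section Convex

variable {E : Type*} [NormedAddCommGroup E] [InnerProductSpace ℝ E]

theorem mem_face_of_forall_le {C : Set E} {u x : E} (hx : x ∈ C)
    (h : ∀ z ∈ C, inner ℝ u z ≤ inner ℝ u x) : x ∈ face C u := by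
  refine ⟨hx, ?_⟩
  have : IsGreatest ((fun x : E => inner ℝ u x) '' C) (inner ℝ u x) :=
    ⟨⟨x, hx, rfl⟩, by rintro _ ⟨z, hz, rfl⟩; exact h z hz⟩
  exact this.csSup_eq.symm

theorem vectorSpan_le_vectorSpan_sum {ι : Type*} {F : ι → Set E} {S : Finset ι} {j : ι}
    (hj : j ∈ S) (hF : ∀ i ∈ S, (F i).Nonempty) :
    vectorSpan ℝ (F j) ≤ vectorSpan ℝ (∑ i ∈ S, F i) := by
  classical
  choose! g hg using hF
  have hrest : ∑ i ∈ S.erase j, g i ∈ ∑ i ∈ S.erase j, F i :=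
    Set.finsetSum_mem_finsetSum _ _ _ fun i hi => hg i (Finset.mem_of_mem_erase hi)
  rw [← Finset.add_sum_erase S F hj, vectorSpan_def, Submodule.span_le]
  rintro _ ⟨p, hp, q, hq, rfl⟩
  have := vsub_mem_vectorSpan ℝ (Set.add_mem_add hp hrest) (Set.add_mem_add hq hrest)
  simpa using this

end Convex

theorem card_le_finrank_of_dual {κ : Type*} [Fintype κ] (W : Submodule ℝ (EuclideanSpace ℝ κ))
    (R : Finset κ) (h : ∀ z ∈ R, ∃ w ∈ W, w z = 1 ∧ ∀ z' ∈ R, z' ≠ z → w z' = 0) :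
    R.card ≤ Module.finrank ℝ W := by
  classical
  choose! w hw h1 h0 using h
  have hli : LinearIndependent ℝ (fun z : R => (⟨w z, hw z z.2⟩ : W)) := by
    rw [Fintype.linearIndependent_iff]
    intro g hg z
    have := congrArg (fun v : W => (v : EuclideanSpace ℝ κ) z) hg
    simp only [Submodule.coe_sum, Submodule.coe_smul, WithLp.ofLp_sum, WithLp.ofLp_smul,
      Finset.sum_apply, Pi.smul_apply, smul_eq_mul, Submodule.coe_zero, WithLp.ofLp_zero,
      Pi.zero_apply] at this
    rw [Finset.sum_eq_single z] at this
    · rwa [h1 z z.2, mul_one] at this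
    · intro b _ hb
      rw [h0 b b.2 z z.2 (fun h => hb (Subtype.ext h.symm)), mul_zero]
    · simp
  simpa using hli.fintype_card_le_finrank

theorem finrank_le_card_of_support {κ : Type*} [Fintype κ]
    (W : Submodule ℝ (EuclideanSpace ℝ κ)) (T : Finset κ)
    (h : ∀ w ∈ W, ∀ z ∉ T, w z = 0) : Module.finrank ℝ W ≤ T.card := by
  let f : W →ₗ[ℝ] (T → ℝ) :=
    { toFun := fun w z => (w : EuclideanSpace ℝ κ) z
      map_add' := fun _ _ => rfl
      map_smul' := fun _ _ => rfl }
  have hf : Function.Injective f := by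
    intro v w hvw
    ext z
    by_cases hz : z ∈ T
    · exact congrFun hvw ⟨z, hz⟩
    · rw [h v v.2 z hz, h w w.2 z hz]
  simpa using LinearMap.finrank_le_finrank_of_injective hf

theorem toExt_lt_toExt {P : Type*} [PartialOrder P] {a b : P} : toExt a < toExt b ↔ a < b := by
  simp [toExt]

theorem toExt_le_toExt {P : Type*} [PartialOrder P] {a b : P} : toExt a ≤ toExt b ↔ a ≤ b := by
  simp [toExt]

namespace ChainData

variable {P : Type*} [PartialOrder P] [Fintype P] (D : ChainData P)

section Chain

theorem chain_zero : D.chain 0 = ⊥ := by simp [chain]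

theorem chain_last : D.chain (D.k + 1) = ⊤ := by simp [chain]

theorem chain_succ {m : ℕ} (h : m < D.k) : D.chain (m + 1) = toExt (D.x ⟨m, h⟩) := by
  simp [chain, h]

theorem chain_lt_succ {m : ℕ} (hm : m ≤ D.k) : D.chain m < D.chain (m + 1) := by
  rcases Nat.lt_or_ge m D.k with h | h
  · rw [D.chain_succ h]
    rcases m with _ | m
    · rw [chain_zero]; exact WithBot.bot_lt_coe _
    · rw [D.chain_succ (by omega), toExt_lt_toExt]
      exact D.x_strictMono (by simp)
  · obtain rfl : m = D.k := le_antisymm hm h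
    rw [chain_last]
    rcases hk : D.k with _ | m
    · rw [chain_zero]; exact bot_lt_top
    · rw [D.chain_succ (by omega)]
      exact WithBot.coe_lt_coe.2 (WithTop.coe_lt_top _)

theorem chain_lt {a b : ℕ} (hab : a < b) (hb : b ≤ D.k + 1) : D.chain a < D.chain b := by
  induction b, hab using Nat.le_induction with
  | base => exact D.chain_lt_succ (by omega)
  | succ b _ ih => exact (ih (by omega)).trans (D.chain_lt_succ (by omega))

theorem chain_le {a b : ℕ} (hab : a ≤ b) (hb : b ≤ D.k + 1) : D.chain a ≤ D.chain b := by
  rcases hab.eq_or_lt with rfl | h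
  exacts [le_rfl, (D.chain_lt h hb).le]

end Chain

section Faces

/-- The elements whose coordinate is not constant on `K_m`. -/
def free (m : ℕ) (z : D.Alpha) : Prop :=
  ¬ toExt (D.val z) < D.chain m ∧ ¬ D.chain (m + 1) < toExt (D.val z)

variable {D}

theorem val_injective : Function.Injective D.val := Subtype.val_injective

open scoped Classical in
/-- The indicator vector of a set of coordinates. -/
noncomputable def ind (U : Set D.Alpha) : D.Space := WithLp.toLp 2 fun y => if y ∈ U then 1 else 0

theorem ind_of_mem {U : Set D.Alpha} {y : D.Alpha} (h : y ∈ U) : ind U y = 1 := by simp [ind, h]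

theorem ind_of_notMem {U : Set D.Alpha} {y : D.Alpha} (h : y ∉ U) : ind U y = 0 := by
  simp [ind, h]

theorem ind_nonneg (U : Set D.Alpha) (y : D.Alpha) : 0 ≤ ind U y := by
  by_cases h : y ∈ U
  · simp [ind_of_mem h]
  · simp [ind_of_notMem h]

theorem ind_le_one (U : Set D.Alpha) (y : D.Alpha) : ind U y ≤ 1 := by
  by_cases h : y ∈ U
  · simp [ind_of_mem h]
  · simp [ind_of_notMem h]

theorem ind_mem_K {m : ℕ} {U : Set D.Alpha} (hU : ∀ u v, D.val u ≤ D.val v → u ∈ U → v ∈ U)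
    (h0 : ∀ y, toExt (D.val y) < D.chain m → y ∉ U)
    (h1 : ∀ y, D.chain (m + 1) < toExt (D.val y) → y ∈ U) : ind U ∈ D.K m := by
  refine ⟨⟨fun y => ⟨ind_nonneg U y, ind_le_one U y⟩, fun u v huv => ?_⟩,
    fun y => ⟨fun h => ind_of_notMem (h0 y h), fun h => ind_of_mem (h1 y h)⟩⟩
  by_cases hu : u ∈ U
  · rw [ind_of_mem hu, ind_of_mem (hU u v huv hu)]
  · rw [ind_of_notMem hu]; exact ind_nonneg U v

/-- The up-set generated by `z` and the elements above `x_{m+1}`, without `z`. -/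
def upperSet (m : ℕ) (z : D.Alpha) : Set D.Alpha :=
  {w | D.chain (m + 1) < toExt (D.val w) ∨ D.val z < D.val w}

/-- The complement of the down-set generated by `z` and the elements below `x_m`. -/
def colowerSet (m : ℕ) (z : D.Alpha) : Set D.Alpha :=
  {w | ¬ toExt (D.val w) < D.chain m ∧ ¬ D.val w ≤ D.val z}

theorem ind_upperSet_mem {m : ℕ} (hm : m ≤ D.k) {z : D.Alpha} (hz : D.free m z) :
    ind (upperSet m z) ∈ D.K m := by
  have hc := D.chain_lt_succ hm
  refine ind_mem_K ?_ ?_ fun y => Or.inl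
  · rintro u v huv (h | h)
    · exact Or.inl (h.trans_le (toExt_le_toExt.2 huv))
    · exact Or.inr (h.trans_le huv)
  · rintro y hy (h | h)
    · exact lt_asymm (hy.trans hc) h
    · exact hz.1 ((toExt_lt_toExt.2 h).trans hy)

theorem ind_insert_upperSet_mem {m : ℕ} (hm : m ≤ D.k) {z : D.Alpha} (hz : D.free m z) :
    ind (insert z (upperSet m z)) ∈ D.K m := by
  have hc := D.chain_lt_succ hm
  refine ind_mem_K ?_ ?_ fun y h => Or.inr (Or.inl h)
  · rintro u v huv (rfl | h | h)
    · rcases huv.eq_or_lt with h | h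
      · exact Or.inl (val_injective h.symm)
      · exact Or.inr (Or.inr h)
    · exact Or.inr (Or.inl (h.trans_le (toExt_le_toExt.2 huv)))
    · exact Or.inr (Or.inr (h.trans_le huv))
  · rintro y hy (rfl | h | h)
    · exact hz.1 hy
    · exact lt_asymm (hy.trans hc) h
    · exact hz.1 ((toExt_lt_toExt.2 h).trans hy)

theorem ind_colowerSet_mem {m : ℕ} (hm : m ≤ D.k) {z : D.Alpha} (hz : D.free m z) :
    ind (colowerSet m z) ∈ D.K m := by
  have hc := D.chain_lt_succ hm
  refine ind_mem_K ?_ (fun y hy h => h.1 hy) ?_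
  · rintro u v huv ⟨h1, h2⟩
    exact ⟨fun h => h1 ((toExt_le_toExt.2 huv).trans_lt h), fun h => h2 (huv.trans h)⟩
  · exact fun y hy => ⟨fun h => lt_asymm (h.trans hc) hy,
      fun h => hz.2 (hy.trans_le (toExt_le_toExt.2 h))⟩

theorem ind_insert_colowerSet_mem {m : ℕ} (hm : m ≤ D.k) {z : D.Alpha} (hz : D.free m z) :
    ind (insert z (colowerSet m z)) ∈ D.K m := by
  have hc := D.chain_lt_succ hm
  refine ind_mem_K ?_ ?_ ?_
  · rintro u v huv (rfl | ⟨h1, h2⟩)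
    · rcases huv.eq_or_lt with h | h
      · exact Or.inl (val_injective h.symm)
      · exact Or.inr ⟨fun h' => hz.1 ((toExt_lt_toExt.2 h).trans h'), not_le_of_gt h⟩
    · exact Or.inr ⟨fun h => h1 ((toExt_le_toExt.2 huv).trans_lt h), fun h => h2 (huv.trans h)⟩
  · rintro y hy (rfl | h)
    · exact hz.1 hy
    · exact h.1 hy
  · exact fun y hy => Or.inr ⟨fun h => lt_asymm (h.trans hc) hy,
      fun h => hz.2 (hy.trans_le (toExt_le_toExt.2 h))⟩

theorem ind_insert_sub {U : Set D.Alpha} {z : D.Alpha} (hz : z ∉ U) :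
    ind (insert z U) - ind U = D.e z := by
  classical
  ext w
  by_cases hw : w = z
  · subst hw
    simp [ind, e, hz]
  · simp [ind, e, hw]

theorem e_mem_of_insert {C : Set D.Space} {U : Set D.Alpha} {z : D.Alpha} (hz : z ∉ U)
    (h : ind U ∈ C) (h' : ind (insert z U) ∈ C) : D.e z ∈ vectorSpan ℝ C := by
  rw [← ind_insert_sub hz]
  exact vsub_mem_vectorSpan ℝ h' h

theorem e_apply_self (z : D.Alpha) : D.e z z = 1 := by simp [e]

theorem e_apply_of_ne {z w : D.Alpha} (h : w ≠ z) : D.e z w = 0 := by simp [e, h]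

theorem inner_e (y : D.Alpha) (t : D.Space) : inner ℝ (D.e y) t = t y := by
  classical
  simp [e, EuclideanSpace.inner_single_left]

theorem inner_e₂ (u v : D.Alpha) (t : D.Space) :
    inner ℝ (D.e₂ u v) t = (Real.sqrt 2)⁻¹ * (t u - t v) := by
  rw [e₂, inner_smul_left, inner_sub_left, inner_e, inner_e]
  simp

theorem norm_e (y : D.Alpha) : ‖D.e y‖ = 1 := by
  classical
  simp [e]

theorem norm_e₂ {u v : D.Alpha} (h : u ≠ v) : ‖D.e₂ u v‖ = 1 := by
  have h1 : ‖D.e₂ u v‖ ^ 2 = 1 := by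
    rw [← real_inner_self_eq_norm_sq, inner_e₂, e₂]
    have h2 : (Real.sqrt 2)⁻¹ * (Real.sqrt 2)⁻¹ = 1 / 2 := by
      rw [← mul_inv, Real.mul_self_sqrt (by norm_num)]; norm_num
    simp only [PiLp.smul_apply, PiLp.sub_apply, e_apply_self, e_apply_of_ne h,
      e_apply_of_ne h.symm, smul_eq_mul]
    linear_combination 2 * h2
  exact (pow_eq_one_iff_of_nonneg (norm_nonneg _) two_ne_zero).1 h1

section Neg

theorem mem_face_neg {m : ℕ} {t : D.Space} {y : D.Alpha} (ht : t ∈ D.K m)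
    (h : t y = 0 ∨ D.chain (m + 1) < toExt (D.val y)) : t ∈ face (D.K m) (-D.e y) := by
  refine mem_face_of_forall_le ht fun s hs => ?_
  rw [inner_neg_left, inner_neg_left, inner_e, inner_e]
  rcases h with h | h
  · linarith [(hs.1.1 y).1]
  · rw [(hs.2 y).2 h, (ht.2 y).2 h]

theorem face_neg_nonempty {m : ℕ} (hm : m ≤ D.k) (y : D.Alpha) :
    (face (D.K m) (-D.e y)).Nonempty := by
  have hc := D.chain_lt_succ hm
  refine ⟨ind {w | D.chain (m + 1) < toExt (D.val w)}, mem_face_neg (ind_mem_K ?_ ?_ ?_) ?_⟩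
  · exact fun u v huv h => lt_of_lt_of_le h (toExt_le_toExt.2 huv)
  · exact fun y hy h => lt_asymm (hy.trans hc) h
  · exact fun y h => h
  · by_cases h : D.chain (m + 1) < toExt (D.val y)
    · exact Or.inr h
    · exact Or.inl (ind_of_notMem h)

theorem e_mem_vectorSpan_face_neg {m : ℕ} (hm : m ≤ D.k) {y z : D.Alpha} (hz : D.free m z)
    (h : D.val z ≤ D.val y → D.chain (m + 1) < toExt (D.val y)) :
    D.e z ∈ vectorSpan ℝ (face (D.K m) (-D.e y)) := by
  have hzU : z ∉ upperSet m z := by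
    rintro (h | h)
    exacts [hz.2 h, lt_irrefl _ h]
  refine e_mem_of_insert hzU (mem_face_neg (ind_upperSet_mem hm hz) ?_)
    (mem_face_neg (ind_insert_upperSet_mem hm hz) ?_)
  · by_cases hy : D.chain (m + 1) < toExt (D.val y)
    · exact Or.inr hy
    · refine Or.inl (ind_of_notMem ?_)
      rintro (h' | h')
      exacts [hy h', hy (h h'.le)]
  · by_cases hy : D.chain (m + 1) < toExt (D.val y)
    · exact Or.inr hy
    · refine Or.inl (ind_of_notMem ?_)
      rintro (rfl | h' | h')
      exacts [hy (h le_rfl), hy h', hy (h h'.le)]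

end Neg

section Pos

theorem mem_face_pos {m : ℕ} {t : D.Space} {y : D.Alpha} (ht : t ∈ D.K m)
    (h : t y = 1 ∨ toExt (D.val y) < D.chain m) : t ∈ face (D.K m) (D.e y) := by
  refine mem_face_of_forall_le ht fun s hs => ?_
  rw [inner_e, inner_e]
  rcases h with h | h
  · linarith [(hs.1.1 y).2]
  · rw [(hs.2 y).1 h, (ht.2 y).1 h]

theorem face_pos_nonempty {m : ℕ} (hm : m ≤ D.k) (y : D.Alpha) :
    (face (D.K m) (D.e y)).Nonempty := by
  have hc := D.chain_lt_succ hm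
  refine ⟨ind {w | ¬ toExt (D.val w) < D.chain m}, mem_face_pos (ind_mem_K ?_ ?_ ?_) ?_⟩
  · exact fun u v huv h h' => h (lt_of_le_of_lt (toExt_le_toExt.2 huv) h')
  · exact fun y hy h => h hy
  · exact fun y h h' => lt_asymm (h'.trans hc) h
  · by_cases h : toExt (D.val y) < D.chain m
    · exact Or.inr h
    · exact Or.inl (ind_of_mem h)

theorem e_mem_vectorSpan_face_pos {m : ℕ} (hm : m ≤ D.k) {y z : D.Alpha} (hz : D.free m z)
    (h : D.val y ≤ D.val z → toExt (D.val y) < D.chain m) :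
    D.e z ∈ vectorSpan ℝ (face (D.K m) (D.e y)) := by
  have hzU : z ∉ colowerSet m z := fun h => h.2 le_rfl
  refine e_mem_of_insert hzU (mem_face_pos (ind_colowerSet_mem hm hz) ?_)
    (mem_face_pos (ind_insert_colowerSet_mem hm hz) ?_)
  · by_cases hy : toExt (D.val y) < D.chain m
    · exact Or.inr hy
    · exact Or.inl (ind_of_mem ⟨hy, fun h' => hy (h h')⟩)
  · by_cases hy : toExt (D.val y) < D.chain m
    · exact Or.inr hy
    · exact Or.inl (ind_of_mem (Or.inr ⟨hy, fun h' => hy (h h')⟩))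

end Pos

section Pair

theorem mem_face_pair {m : ℕ} {t : D.Space} {u v : D.Alpha} (huv : D.val u < D.val v)
    (ht : t ∈ D.K m) (h : t u = t v ∨
      toExt (D.val u) < D.chain m ∧ D.chain (m + 1) < toExt (D.val v)) :
    t ∈ face (D.K m) (D.e₂ u v) := by
  refine mem_face_of_forall_le ht fun s hs => ?_
  rw [inner_e₂, inner_e₂]
  rcases h with h | h
  · have h1 : s u - s v ≤ t u - t v := by
      have := hs.1.2 u v huv.le
      linarith
    exact mul_le_mul_of_nonneg_left h1 (by positivity)
  · rw [(hs.2 u).1 h.1, (ht.2 u).1 h.1, (hs.2 v).2 h.2, (ht.2 v).2 h.2]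

theorem ind_eq_ind {U : Set D.Alpha} {u v : D.Alpha} (h : u ∈ U ↔ v ∈ U) :
    ind U u = ind U v := by
  by_cases hu : u ∈ U
  · rw [ind_of_mem hu, ind_of_mem (h.1 hu)]
  · rw [ind_of_notMem hu, ind_of_notMem (fun hv => hu (h.2 hv))]

theorem face_pair_nonempty {m : ℕ} (hm : m ≤ D.k) {u v : D.Alpha} (huv : D.val u < D.val v) :
    (face (D.K m) (D.e₂ u v)).Nonempty := by
  have hc := D.chain_lt_succ hm
  have huv' := toExt_lt_toExt.2 huv
  by_cases h : toExt (D.val u) < D.chain m ∧ ¬ toExt (D.val v) < D.chain m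
  · refine ⟨ind {w | D.chain (m + 1) < toExt (D.val w)},
      mem_face_pair huv (ind_mem_K ?_ ?_ ?_) ?_⟩
    · exact fun u v huv h => lt_of_lt_of_le h (toExt_le_toExt.2 huv)
    · exact fun y hy h => lt_asymm (hy.trans hc) h
    · exact fun y h => h
    · by_cases hv : D.chain (m + 1) < toExt (D.val v)
      · exact Or.inr ⟨h.1, hv⟩
      · exact Or.inl (ind_eq_ind ⟨fun h' => h'.trans huv', fun h' => absurd h' hv⟩)
  · refine ⟨ind {w | ¬ toExt (D.val w) < D.chain m},
      mem_face_pair huv (ind_mem_K ?_ ?_ ?_) (Or.inl (ind_eq_ind ?_))⟩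
    · exact fun u v huv h h' => h (lt_of_le_of_lt (toExt_le_toExt.2 huv) h')
    · exact fun y hy h => h hy
    · exact fun y h h' => lt_asymm (h'.trans hc) h
    · exact ⟨fun h1 h2 => h1 (huv'.trans h2), fun h1 h2 => h ⟨h2, h1⟩⟩

theorem e_mem_vectorSpan_face_pair {m : ℕ} (hm : m ≤ D.k) {u v z : D.Alpha}
    (huv : D.val u < D.val v) (hz : D.free m z) (hzu : z ≠ u) (hzv : z ≠ v)
    (hbetween : ¬ (D.val u < D.val z ∧ D.val z < D.val v))
    (h1 : D.chain (m + 1) < toExt (D.val v) → ¬ D.val u ≤ D.val z)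
    (h0 : toExt (D.val u) < D.chain m → ¬ D.val z ≤ D.val v) :
    D.e z ∈ vectorSpan ℝ (face (D.K m) (D.e₂ u v)) := by
  have huv' := toExt_lt_toExt.2 huv
  have hlt : ∀ {a b : D.Alpha}, a ≠ b → D.val a ≤ D.val b → D.val a < D.val b :=
    fun hab h => lt_of_le_of_ne h fun h' => hab (val_injective h')
  by_cases hall : toExt (D.val u) < D.chain m ∧ D.chain (m + 1) < toExt (D.val v)
  · have hzU : z ∉ colowerSet m z := fun h => h.2 le_rfl
    exact e_mem_of_insert hzU (mem_face_pair huv (ind_colowerSet_mem hm hz) (Or.inr hall))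
      (mem_face_pair huv (ind_insert_colowerSet_mem hm hz) (Or.inr hall))
  by_cases hup : v ∈ upperSet m z → u ∈ upperSet m z
  · have hiff : u ∈ upperSet m z ↔ v ∈ upperSet m z := by
      refine ⟨?_, hup⟩
      rintro (h | h)
      exacts [Or.inl (h.trans huv'), Or.inr (h.trans huv)]
    have hzU : z ∉ upperSet m z := by
      rintro (h | h)
      exacts [hz.2 h, lt_irrefl _ h]
    refine e_mem_of_insert hzU
      (mem_face_pair huv (ind_upperSet_mem hm hz) (Or.inl (ind_eq_ind hiff)))
      (mem_face_pair huv (ind_insert_upperSet_mem hm hz) (Or.inl (ind_eq_ind ?_)))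
    simp only [Set.mem_insert_iff, hzu.symm, hzv.symm, false_or, hiff]
  · have hiff : u ∈ colowerSet m z ↔ v ∈ colowerSet m z := by
      refine ⟨fun h => ⟨fun h' => h.1 (huv'.trans h'), fun h' => h.2 (huv.le.trans h')⟩,
        fun h => ?_⟩
      rw [Classical.not_imp] at hup
      obtain ⟨hv, hu⟩ := hup
      refine ⟨fun hu0 => ?_, fun huz => ?_⟩
      · rcases hv with hv | hv
        · exact hall ⟨hu0, hv⟩
        · exact h0 hu0 hv.le
      · rcases hv with hv | hv
        · exact h1 hv huz
        · exact hbetween ⟨hlt hzu.symm huz, hv⟩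
    have hzU : z ∉ colowerSet m z := fun h => h.2 le_rfl
    refine e_mem_of_insert hzU
      (mem_face_pair huv (ind_colowerSet_mem hm hz) (Or.inl (ind_eq_ind hiff)))
      (mem_face_pair huv (ind_insert_colowerSet_mem hm hz) (Or.inl (ind_eq_ind ?_)))
    simp only [Set.mem_insert_iff, hzu.symm, hzv.symm, false_or, hiff]

theorem e_add_e_mem_vectorSpan_face_pair {m : ℕ} (hm : m ≤ D.k) {u v : D.Alpha}
    (huv : D.val u < D.val v) (hu : D.free m u) (hv : D.free m v)
    (hbetween : ∀ z : D.Alpha, ¬ (D.val u < D.val z ∧ D.val z < D.val v)) :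
    D.e u + D.e v ∈ vectorSpan ℝ (face (D.K m) (D.e₂ u v)) := by
  have hc := D.chain_lt_succ hm
  have huU : u ∉ upperSet m u := by
    rintro (h | h)
    exacts [hu.2 h, lt_irrefl _ h]
  have hvU : v ∈ upperSet m u := Or.inr huv
  have huv' : u ≠ v := fun h => huv.ne (congrArg D.val h)
  have h1 : ind (insert u (upperSet m u)) ∈ face (D.K m) (D.e₂ u v) :=
    mem_face_pair huv (ind_insert_upperSet_mem hm hu)
      (Or.inl (ind_eq_ind ⟨fun _ => Or.inr hvU, fun _ => Or.inl rfl⟩))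
  have h0 : ind (upperSet m u \ {v}) ∈ face (D.K m) (D.e₂ u v) := by
    refine mem_face_pair huv (ind_mem_K ?_ ?_ ?_)
      (Or.inl (ind_eq_ind ⟨fun h => absurd h.1 huU, fun h => absurd rfl h.2⟩))
    · rintro a b hab ⟨h | h, hav⟩
      · have hb := h.trans_le (toExt_le_toExt.2 hab)
        exact ⟨Or.inl hb, by rintro rfl; exact hv.2 hb⟩
      · refine ⟨Or.inr (h.trans_le hab), ?_⟩
        rintro rfl
        exact hbetween a ⟨h, lt_of_le_of_ne hab fun h' => hav (val_injective h')⟩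
    · rintro y hy ⟨h | h, -⟩
      · exact lt_asymm (hy.trans hc) h
      · exact hu.1 ((toExt_lt_toExt.2 h).trans hy)
    · intro y hy
      exact ⟨Or.inl hy, by rintro rfl; exact hv.2 hy⟩
  have h2 : D.e u + D.e v = ind (insert u (upperSet m u)) - ind (upperSet m u \ {v}) := by
    have h3 : insert v (upperSet m u \ {v}) = upperSet m u := Set.insert_sdiff_self_of_mem hvU
    have h4 : v ∉ upperSet m u \ {v} := fun h => h.2 rfl
    rw [← ind_insert_sub huU, ← ind_insert_sub h4, h3, sub_add_sub_cancel]
  rw [h2]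
  exact vsub_mem_vectorSpan ℝ h1 h0

end Pair

end Faces

end ChainData

end Stanley
namespace Stanley
namespace ChainData

variable {P : Type*} [PartialOrder P] [Fintype P] (D : ChainData P)

section Positions

/-- The positions of the chain in the linear extensions in `extensionsAt p`. -/
def pos (p m : ℕ) : ℕ := if m = D.l then p else D.i m

theorem pos_i_l : D.pos (D.i D.l) = D.i := by
  funext m
  by_cases h : m = D.l <;> simp [pos, h]

theorem pos_of_ne {p m : ℕ} (h : m ≠ D.l) : D.pos p m = D.i m := by simp [pos, h]

theorem pos_l (p : ℕ) : D.pos p D.l = p := by simp [pos]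

/-- The position `p` is strictly between `i_{ℓ-1}` and `i_{ℓ+1}`. -/
def Admissible (p : ℕ) : Prop := D.i (D.l - 1) < p ∧ p < D.i (D.l + 1)

theorem admissible_i_l : D.Admissible (D.i D.l) := by
  have := D.gap_left
  have := D.gap_right
  constructor <;> omega

theorem admissible_i_l_add_one : D.Admissible (D.i D.l + 1) := by
  have := D.gap_left
  have := D.gap_right
  constructor <;> omega

theorem admissible_i_l_sub_one : D.Admissible (D.i D.l - 1) := by
  have := D.gap_left
  have := D.gap_right
  constructor <;> omega

variable {D} {p : ℕ} {σ : P → ℕ}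

theorem pos_lt_succ (hp : D.Admissible p) {m : ℕ} (hm : m ≤ D.k) :
    D.pos p m < D.pos p (m + 1) := by
  have h1 := D.one_le_l
  have h2 := D.i_lt m hm
  obtain ⟨h3, h4⟩ := hp
  rcases eq_or_ne m D.l with h | h
  · rw [D.pos_of_ne (show m + 1 ≠ D.l by omega), h, pos_l]; exact h4
  · rw [D.pos_of_ne h]
    rcases eq_or_ne (m + 1) D.l with h' | h'
    · rw [h', pos_l, show m = D.l - 1 by omega]; exact h3
    · rw [D.pos_of_ne h']; exact h2

theorem pos_lt (hp : D.Admissible p) {a b : ℕ} (hab : a < b) (hb : b ≤ D.k + 1) :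
    D.pos p a < D.pos p b := by
  induction b, hab using Nat.le_induction with
  | base => exact pos_lt_succ hp (by omega)
  | succ b _ ih => exact (ih (by omega)).trans (pos_lt_succ hp (by omega))

theorem pos_le (hp : D.Admissible p) {a b : ℕ} (hab : a ≤ b) (hb : b ≤ D.k + 1) :
    D.pos p a ≤ D.pos p b := by
  rcases hab.eq_or_lt with rfl | h
  exacts [le_rfl, (pos_lt hp h hb).le]

theorem lt_of_pos_lt (hp : D.Admissible p) {a b : ℕ} (ha : a ≤ D.k + 1)
    (h : D.pos p a < D.pos p b) : a < b := by
  by_contra h'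
  exact absurd (pos_le hp (not_lt.1 h') ha) (not_le.2 h)

theorem i_mono {a b : ℕ} (hab : a ≤ b) (hb : b ≤ D.k + 1) : D.i a ≤ D.i b := by
  have := pos_le D.admissible_i_l hab hb
  rwa [pos_i_l] at this

theorem i_strict {a b : ℕ} (hab : a < b) (hb : b ≤ D.k + 1) : D.i a < D.i b := by
  have := pos_lt D.admissible_i_l hab hb
  rwa [pos_i_l] at this

theorem pos_zero : D.pos p 0 = 0 := by
  rw [D.pos_of_ne (by have := D.one_le_l; omega), D.i_zero]

theorem pos_last : D.pos p (D.k + 1) = Fintype.card P + 1 := by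
  rw [D.pos_of_ne (by have := D.l_le_k; omega), D.i_last]

variable (hσ : σ ∈ D.extensionsAt p)
include hσ

theorem one_le_apply (z : P) : 1 ≤ σ z := (hσ.1.1.mapsTo (Set.mem_univ z)).1

theorem apply_le_card (z : P) : σ z ≤ Fintype.card P := (hσ.1.1.mapsTo (Set.mem_univ z)).2

theorem apply_injective : Function.Injective σ :=
  fun a b h => hσ.1.1.injOn (Set.mem_univ a) (Set.mem_univ b) h

theorem apply_lt {a b : P} (h : a < b) : σ a < σ b :=
  lt_of_le_of_ne (hσ.1.2 a b h.le) fun h' => h.ne (apply_injective hσ h')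

theorem apply_chain (m : Fin D.k) : σ (D.x m) = D.pos p (m + 1) := hσ.2 m

theorem pos_lt_apply {m : ℕ} {z : P} (h : D.chain m < toExt z) : D.pos p m < σ z := by
  rcases m with _ | m
  · rw [pos_zero]; exact one_le_apply hσ z
  · rcases Nat.lt_or_ge m D.k with hm | hm
    · rw [D.chain_succ hm, toExt_lt_toExt] at h
      rw [← apply_chain hσ ⟨m, hm⟩]
      exact apply_lt hσ h
    · rw [chain, if_neg (by omega), dif_neg (by simpa using hm)] at h
      exact absurd h not_top_lt

theorem apply_lt_pos {m : ℕ} (hm : m ≤ D.k + 1) {z : P} (h : toExt z < D.chain m) :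
    σ z < D.pos p m := by
  rcases m with _ | m
  · rw [chain_zero] at h; exact absurd h not_lt_bot
  · rcases Nat.lt_or_ge m D.k with hm' | hm'
    · rw [D.chain_succ hm', toExt_lt_toExt] at h
      rw [← apply_chain hσ ⟨m, hm'⟩]
      exact apply_lt hσ h
    · obtain rfl : m = D.k := by omega
      rw [pos_last]
      exact Nat.lt_succ_of_le (apply_le_card hσ z)

theorem apply_val_ne_pos {m : ℕ} (hm : m ≤ D.k + 1) (z : D.Alpha) : σ (D.val z) ≠ D.pos p m := by
  intro h
  rcases m with _ | m
  · rw [pos_zero] at h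
    have := one_le_apply hσ (D.val z)
    omega
  · rcases Nat.lt_or_ge m D.k with hm' | hm'
    · rw [← apply_chain hσ ⟨m, hm'⟩] at h
      exact z.2 ⟨⟨m, hm'⟩, (apply_injective hσ h).symm⟩
    · obtain rfl : m = D.k := by omega
      rw [pos_last] at h
      have := apply_le_card hσ (D.val z)
      omega

theorem free_of_slot {m : ℕ} (hm : m ≤ D.k) {z : D.Alpha} (h : D.pos p m < σ (D.val z))
    (h' : σ (D.val z) < D.pos p (m + 1)) : D.free m z :=
  ⟨fun hz => lt_asymm h (apply_lt_pos hσ (by omega) hz),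
    fun hz => lt_asymm h' (pos_lt_apply hσ hz)⟩

theorem exists_slot (z : D.Alpha) :
    ∃ m ≤ D.k, D.pos p m < σ (D.val z) ∧ σ (D.val z) < D.pos p (m + 1) := by
  have key : ∀ j ≤ D.k + 1, σ (D.val z) < D.pos p j →
      ∃ m ≤ D.k, D.pos p m < σ (D.val z) ∧ σ (D.val z) < D.pos p (m + 1) := by
    intro j
    induction j with
    | zero => intro _ h; rw [pos_zero] at h; omega
    | succ j ih =>
      intro hj h
      rcases lt_or_gt_of_ne (apply_val_ne_pos hσ (show j ≤ D.k + 1 by omega) z) with h' | h'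
      · exact ih (by omega) h'
      · exact ⟨j, by omega, h', h⟩
  refine key (D.k + 1) le_rfl ?_
  rw [pos_last]
  exact Nat.lt_succ_of_le (apply_le_card hσ _)

theorem exists_apply_eq {a : ℕ} (h1 : 1 ≤ a) (h2 : a ≤ Fintype.card P) : ∃ z, σ z = a := by
  obtain ⟨z, -, hz⟩ := hσ.1.1.surjOn ⟨h1, h2⟩
  exact ⟨z, hz⟩

end Positions

section Slots

open scoped Classical in
/-- The elements with a value in one of the intervals `(q_m, q_{m+1})`, `m ∈ M`. -/
noncomputable def slots (q : ℕ → ℕ) (σ : P → ℕ) (M : Finset ℕ) : Finset D.Alpha :=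
  Finset.univ.filter fun z => ∃ m ∈ M, q m < σ (D.val z) ∧ σ (D.val z) < q (m + 1)

variable {D} {p : ℕ} {σ : P → ℕ} {M : Finset ℕ}

theorem mem_slots {q : ℕ → ℕ} {z : D.Alpha} :
    z ∈ D.slots q σ M ↔ ∃ m ∈ M, q m < σ (D.val z) ∧ σ (D.val z) < q (m + 1) := by
  simp [slots]

theorem card_le_of_apply_mem_Ioc (hσ : σ ∈ D.extensionsAt p) {X : Finset D.Alpha} {a b : ℕ}
    (hX : ∀ z ∈ X, a < σ (D.val z) ∧ σ (D.val z) ≤ b) : X.card ≤ b - a := by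
  rw [← Nat.card_Ioc]
  refine Finset.card_le_card_of_injOn (fun z => σ (D.val z)) (fun z hz => ?_) ?_
  · simpa using hX z hz
  · exact fun z _ w _ h => val_injective (apply_injective hσ h)

theorem sum_le_card_slots (hσ : σ ∈ D.extensionsAt p) (hp : D.Admissible p)
    (hM : ∀ m ∈ M, m ≤ D.k) :
    ∑ m ∈ M, (D.pos p (m + 1) - D.pos p m - 1) ≤ (D.slots (D.pos p) σ M).card := by
  classical
  have hcard : (M.biUnion fun m => Finset.Ioo (D.pos p m) (D.pos p (m + 1))).card =
      ∑ m ∈ M, (D.pos p (m + 1) - D.pos p m - 1) := by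
    rw [Finset.card_biUnion]
    · simp
    · intro a ha b hb hab
      rw [Function.onFun, Finset.disjoint_left]
      intro c hca hcb
      rw [Finset.mem_Ioo] at hca hcb
      have h1 := lt_of_pos_lt hp (show a ≤ D.k + 1 by have := hM a ha; omega) (hca.1.trans hcb.2)
      have h2 := lt_of_pos_lt hp (show b ≤ D.k + 1 by have := hM b hb; omega) (hcb.1.trans hca.2)
      omega
  rw [← hcard]
  refine (Finset.card_le_card (t := (D.slots (D.pos p) σ M).image fun z => σ (D.val z)) ?_).trans
    Finset.card_image_le
  intro c hc
  simp only [Finset.mem_biUnion, Finset.mem_Ioo] at hc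
  obtain ⟨m, hm, h1, h2⟩ := hc
  have hmk := hM m hm
  have h3 := pos_le hp (show m + 1 ≤ D.k + 1 by omega) le_rfl
  rw [pos_last] at h3
  obtain ⟨z, rfl⟩ := exists_apply_eq hσ (a := c) (by omega) (by omega)
  have hz : z ∉ Set.range D.x := by
    rintro ⟨j, rfl⟩
    rw [apply_chain hσ] at h1 h2
    have h4 := lt_of_pos_lt hp (by omega) h1
    have h5 := lt_of_pos_lt hp (by omega) h2
    omega
  exact Finset.mem_image.2 ⟨⟨z, hz⟩, mem_slots.2 ⟨m, hm, h1, h2⟩, rfl⟩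

theorem card_slots_le_sum (hσ : σ ∈ D.extensionsAt p) :
    (D.slots (D.pos p) σ M).card ≤ ∑ m ∈ M, (D.pos p (m + 1) - D.pos p m - 1) := by
  classical
  have hcard : (M.biUnion fun m => Finset.Ioo (D.pos p m) (D.pos p (m + 1))).card ≤
      ∑ m ∈ M, (D.pos p (m + 1) - D.pos p m - 1) := by
    refine Finset.card_biUnion_le.trans (le_of_eq ?_)
    simp
  refine le_trans (Finset.card_le_card_of_injOn (fun z => σ (D.val z)) (fun z hz => ?_) ?_) hcard
  · simpa only [Finset.coe_biUnion, Finset.coe_Ioo, Set.mem_iUnion, Set.mem_Ioo, exists_prop,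
      Finset.mem_coe] using mem_slots.1 hz
  · exact fun z _ w _ h => val_injective (apply_injective hσ h)

end Slots

section Support

/-- The indices `m` such that a subcollection contains a copy of `K_m`. -/
def support (S : Finset D.Index) : Finset ℕ := S.image fun j => (j.1 : ℕ)

variable {D} {S : Finset D.Index} {σ : P → ℕ}

theorem mem_support {m : ℕ} : m ∈ D.support S ↔ ∃ j ∈ S, (j.1 : ℕ) = m := by simp [support]

theorem le_k_of_mem_support {m : ℕ} (h : m ∈ D.support S) : m ≤ D.k := by
  obtain ⟨j, -, rfl⟩ := mem_support.1 h
  exact Nat.lt_succ_iff.1 j.1.2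

theorem card_le_sum_mult : S.card ≤ ∑ m ∈ D.support S, D.mult m := by
  rw [support, Finset.card_eq_sum_card_image (fun j : D.Index => (j.1 : ℕ)) S]
  refine Finset.sum_le_sum fun m _ => ?_
  rw [← Finset.card_range (D.mult m)]
  refine Finset.card_le_card_of_injOn (fun j => (j.2 : ℕ)) ?_ ?_
  · rintro ⟨a, b⟩ hj
    simp only [Finset.coe_filter, Set.mem_ofPred_eq] at hj
    obtain ⟨-, rfl⟩ := hj
    simp
  · rintro ⟨a, b⟩ hj ⟨a', b'⟩ hj' h
    simp only [Finset.coe_filter, Set.mem_ofPred_eq] at hj hj'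
    obtain rfl : a = a' := Fin.ext (hj.2.trans hj'.2.symm)
    simpa [Fin.ext_iff] using h

theorem card_add_le_card_slots {p : ℕ} (hσ : σ ∈ D.extensionsAt p) (hp : D.Admissible p)
    (c d : ℕ) (h : ∀ m ≤ D.k, D.mult m + ((if m = D.l - 1 then c else 0) +
      (if m = D.l then d else 0)) ≤ D.pos p (m + 1) - D.pos p m - 1) :
    S.card + ((if D.l - 1 ∈ D.support S then c else 0) + (if D.l ∈ D.support S then d else 0)) ≤
      (D.slots (D.pos p) σ (D.support S)).card := by
  refine le_trans ?_ (sum_le_card_slots hσ hp fun m => le_k_of_mem_support)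
  refine le_trans ?_ (Finset.sum_le_sum fun m hm => h m (le_k_of_mem_support hm))
  rw [Finset.sum_add_distrib, Finset.sum_add_distrib, Finset.sum_ite_eq', Finset.sum_ite_eq']
  exact Nat.add_le_add_right card_le_sum_mult _

theorem mult_l : D.mult D.l + 2 = D.i (D.l + 1) - D.i D.l := by
  have := D.gap_right
  rw [mult, if_pos (Or.inr rfl)]
  omega

theorem mult_l_sub_one : D.mult (D.l - 1) + 2 = D.i D.l - D.i (D.l - 1) := by
  have h := D.gap_left
  have h1 : D.l - 1 + 1 = D.l := Nat.sub_add_cancel D.one_le_l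
  rw [mult, if_pos (Or.inl h1), h1]
  omega

theorem mult_of_ne {m : ℕ} (hm : m ≤ D.k) (h : m ≠ D.l) (h' : m ≠ D.l - 1) :
    D.mult m + 1 = D.i (m + 1) - D.i m := by
  have := D.i_lt m hm
  rw [mult, if_neg (by omega)]
  omega

theorem card_add_le_card_slots_of_mem_Neq (hσ : σ ∈ D.Neq) :
    S.card + ((if D.l - 1 ∈ D.support S then 1 else 0) + (if D.l ∈ D.support S then 1 else 0)) ≤
      (D.slots D.i σ (D.support S)).card := by
  have := card_add_le_card_slots (S := S) hσ D.admissible_i_l 1 1 ?_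
  · rwa [pos_i_l] at this
  intro m hm
  have h1 := D.one_le_l
  have h3 := D.gap_left
  have h4 := D.gap_right
  rcases eq_or_ne m D.l with rfl | h5
  · rw [if_neg (by omega), if_pos rfl, pos_l, D.pos_of_ne (by omega)]
    have := D.mult_l
    omega
  · rcases eq_or_ne m (D.l - 1) with rfl | h6
    · rw [if_pos rfl, if_neg h5, D.pos_of_ne h5, Nat.sub_add_cancel h1, pos_l]
      have := D.mult_l_sub_one
      omega
    · rw [if_neg h6, if_neg h5, D.pos_of_ne h5, D.pos_of_ne (by omega)]
      have := mult_of_ne hm h5 h6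
      omega

theorem card_add_le_card_slots_of_mem_Nplus (hσ : σ ∈ D.Nplus) :
    S.card + (if D.l - 1 ∈ D.support S then 2 else 0) ≤
      (D.slots (D.pos (D.i D.l + 1)) σ (D.support S)).card := by
  have := card_add_le_card_slots (S := S) hσ D.admissible_i_l_add_one 2 0 ?_
  · simpa using this
  intro m hm
  have h1 := D.one_le_l
  have h3 := D.gap_left
  have h4 := D.gap_right
  rcases eq_or_ne m D.l with rfl | h5
  · rw [if_neg (by omega), if_pos rfl, pos_l, D.pos_of_ne (by omega)]
    have := D.mult_l
    omega
  · rcases eq_or_ne m (D.l - 1) with rfl | h6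
    · rw [if_pos rfl, if_neg h5, D.pos_of_ne h5, Nat.sub_add_cancel h1, pos_l]
      have := D.mult_l_sub_one
      omega
    · rw [if_neg h6, if_neg h5, D.pos_of_ne h5, D.pos_of_ne (by omega)]
      have := mult_of_ne hm h5 h6
      omega

theorem card_add_le_card_slots_of_mem_Nminus (hσ : σ ∈ D.Nminus) :
    S.card + (if D.l ∈ D.support S then 2 else 0) ≤
      (D.slots (D.pos (D.i D.l - 1)) σ (D.support S)).card := by
  have := card_add_le_card_slots (S := S) hσ D.admissible_i_l_sub_one 0 2 ?_
  · simpa using this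
  intro m hm
  have h1 := D.one_le_l
  have h3 := D.gap_left
  have h4 := D.gap_right
  rcases eq_or_ne m D.l with rfl | h5
  · rw [if_neg (by omega), if_pos rfl, pos_l, D.pos_of_ne (by omega)]
    have := D.mult_l
    omega
  · rcases eq_or_ne m (D.l - 1) with rfl | h6
    · rw [if_pos rfl, if_neg h5, D.pos_of_ne h5, Nat.sub_add_cancel h1, pos_l]
      have := D.mult_l_sub_one
      omega
    · rw [if_neg h6, if_neg h5, D.pos_of_ne h5, D.pos_of_ne (by omega)]
      have := mult_of_ne hm h5 h6
      omega

end Support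

section Extras

open scoped Classical in
/-- The elements with a value between `i_b` and `i_c` which are not between `x_b` and `x_c`. -/
noncomputable def extras (σ : P → ℕ) (b c : ℕ) : Finset D.Alpha :=
  Finset.univ.filter fun z => (D.i b < σ (D.val z) ∧ σ (D.val z) < D.i c) ∧
    ¬ (D.chain b < toExt (D.val z) ∧ toExt (D.val z) < D.chain c)

variable {D} {σ : P → ℕ} {b c : ℕ}

theorem mem_extras {z : D.Alpha} : z ∈ D.extras σ b c ↔
    (D.i b < σ (D.val z) ∧ σ (D.val z) < D.i c) ∧
      ¬ (D.chain b < toExt (D.val z) ∧ toExt (D.val z) < D.chain c) := by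
  simp [extras]

theorem extras_nonempty (hσ : σ ∈ D.Neq) (hsplit : D.SplittingBound)
    (hbc : D.IsSplittingPair b c) : (D.extras σ b c).Nonempty := by
  classical
  by_contra hempty
  rw [Finset.not_nonempty_iff_eq_empty] at hempty
  have hbound := hsplit b c hbc
  obtain ⟨hlt, hck, -⟩ := hbc
  have hi : D.i b < D.i c := i_strict hlt hck
  have hic : D.i c ≤ Fintype.card P + 1 := D.i_last ▸ i_mono hck le_rfl
  set T : Finset P := Finset.univ.filter fun z => D.i b < σ z ∧ σ z < D.i c with hT
  have hTcard : D.i c - D.i b - 1 ≤ T.card := by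
    rw [← Nat.card_Ioo]
    refine (Finset.card_le_card (t := T.image σ) ?_).trans Finset.card_image_le
    intro a ha
    rw [Finset.mem_Ioo] at ha
    obtain ⟨z, rfl⟩ := exists_apply_eq hσ (a := a) (by omega) (by omega)
    exact Finset.mem_image_of_mem σ (by simpa [hT] using ha)
  have hbetween : ∀ z ∈ T, D.chain b < toExt z ∧ toExt z < D.chain c := by
    intro z hz
    have hz' : D.i b < σ z ∧ σ z < D.i c := by simpa [hT] using hz
    by_cases hzx : z ∈ Set.range D.x
    · obtain ⟨j, rfl⟩ := hzx
      rw [apply_chain hσ] at hz'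
      have h1 : b < j + 1 :=
        lt_of_pos_lt D.admissible_i_l (by omega) (by rw [pos_i_l] at *; exact hz'.1)
      have h2 : (j : ℕ) + 1 < c :=
        lt_of_pos_lt D.admissible_i_l (by omega) (by rw [pos_i_l] at *; exact hz'.2)
      have h3 := D.chain_succ j.2
      rw [← h3]
      exact ⟨D.chain_lt h1 (by omega), D.chain_lt h2 hck⟩
    · by_contra h
      have : (⟨z, hzx⟩ : D.Alpha) ∈ D.extras σ b c := mem_extras.2 ⟨hz', h⟩
      rw [hempty] at this
      exact absurd this (Finset.notMem_empty _)
  set U : Finset (Ext P) := insert (D.chain b) (insert (D.chain c) (T.image toExt)) with hU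
  have hUcard : U.card = T.card + 2 := by
    rw [hU, Finset.card_insert_of_notMem, Finset.card_insert_of_notMem,
      Finset.card_image_of_injective]
    · intro a b h
      simpa [toExt] using h
    · intro h
      obtain ⟨z, hz, hzc⟩ := Finset.mem_image.1 h
      exact (hbetween z hz).2.ne hzc
    · intro h
      rcases Finset.mem_insert.1 h with h | h
      · exact (D.chain_lt hlt hck).ne h
      · obtain ⟨z, hz, hzc⟩ := Finset.mem_image.1 h
        exact (hbetween z hz).1.ne hzc.symm
  have hsub : (U : Set (Ext P)) ⊆ Set.Icc (D.chain b) (D.chain c) := by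
    intro z hz
    rw [hU, Finset.mem_coe, Finset.mem_insert, Finset.mem_insert, Finset.mem_image] at hz
    have hbc := (D.chain_lt hlt hck).le
    rcases hz with rfl | rfl | ⟨z, hz, rfl⟩
    · exact ⟨le_rfl, hbc⟩
    · exact ⟨hbc, le_rfl⟩
    · exact ⟨(hbetween z hz).1.le, (hbetween z hz).2.le⟩
  have hfin : Finite (Ext P) := inferInstanceAs (Finite (Option (Option P)))
  have h1 := Set.ncard_le_ncard hsub (Set.toFinite _)
  rw [Set.ncard_coe_finset] at h1
  omega

theorem exists_free_of_mem_extras (hσ : σ ∈ D.Neq) {M : Finset ℕ} (hlt : b < c)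
    (hck : c ≤ D.k + 1) (hb : b = 0 ∨ b - 1 ∈ M) (hc : c = D.k + 1 ∨ c ∈ M) {z : D.Alpha}
    (hz : z ∈ D.extras σ b c) : ∃ m ∈ M, (m + 1 = b ∨ m = c) ∧ D.free m z := by
  obtain ⟨⟨h1, h2⟩, h3⟩ := mem_extras.1 hz
  by_cases h : D.chain b < toExt (D.val z)
  · have h4 : ¬ toExt (D.val z) < D.chain c := fun h' => h3 ⟨h, h'⟩
    rcases hc with rfl | hc
    · rw [chain_last] at h4
      exact absurd (WithBot.coe_lt_coe.2 (WithTop.coe_lt_top _)) h4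
    · refine ⟨c, hc, Or.inr rfl, h4, fun h5 => ?_⟩
      have := pos_lt_apply hσ h5
      rw [pos_i_l] at this
      rcases hck.eq_or_lt with rfl | hck
      · rw [chain_last] at h4
        exact absurd (WithBot.coe_lt_coe.2 (WithTop.coe_lt_top _)) h4
      · have := D.i_lt c (by omega)
        omega
  · rcases hb with rfl | hb
    · rw [chain_zero] at h
      exact absurd (WithBot.bot_lt_coe _) h
    · rcases Nat.eq_zero_or_pos b with rfl | hpos
      · rw [chain_zero] at h
        exact absurd (WithBot.bot_lt_coe _) h
      refine ⟨b - 1, hb, Or.inl (by omega), fun h5 => ?_, by rwa [Nat.sub_add_cancel hpos]⟩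
      have := apply_lt_pos hσ (by omega) h5
      rw [pos_i_l] at this
      have := D.i_lt (b - 1) (by omega)
      rw [Nat.sub_add_cancel hpos] at this
      omega

theorem disjoint_extras_slots {M : Finset ℕ} (hM : ∀ m ∈ M, m ≤ D.k) (hlt : b < c)
    (hck : c ≤ D.k + 1) (h : ∀ m ∈ M, m < b ∨ c ≤ m) : Disjoint (D.extras σ b c) (D.slots D.i σ M) := by
  rw [Finset.disjoint_left]
  intro z hz hz'
  obtain ⟨⟨h1, h2⟩, -⟩ := mem_extras.1 hz
  obtain ⟨m, hm, h3, h4⟩ := mem_slots.1 hz'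
  have hmk := hM m hm
  rcases h m hm with h5 | h5
  · have := i_mono (D := D) (show m + 1 ≤ b by omega) (by omega)
    omega
  · have := i_mono (D := D) h5 (by omega)
    omega

theorem apply_eq_of_mem_K {m : ℕ} {s t : D.Space} (hs : s ∈ D.K m) (ht : t ∈ D.K m)
    {z : D.Alpha} (hz : ¬ D.free m z) : s z = t z := by
  rw [free, not_and_or, not_not, not_not] at hz
  rcases hz with hz | hz
  · rw [(hs.2 z).1 hz, (ht.2 z).1 hz]
  · rw [(hs.2 z).2 hz, (ht.2 z).2 hz]

theorem dim_sum_collection_le {S : Finset D.Index} {T : Finset D.Alpha}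
    (hT : ∀ j ∈ S, ∀ z, D.free j.1 z → z ∈ T) : dim (∑ j ∈ S, D.collection j) ≤ T.card := by
  refine finrank_le_card_of_support _ _ fun w hw z hz => ?_
  have hle : vectorSpan ℝ (∑ j ∈ S, D.collection j) ≤
      LinearMap.ker (EuclideanSpace.proj (𝕜 := ℝ) z).toLinearMap := by
    rw [vectorSpan_def, Submodule.span_le]
    rintro _ ⟨s, hs, t, ht, rfl⟩
    obtain ⟨f, hf, rfl⟩ := (Set.mem_finsetSum _ _ _).1 hs
    obtain ⟨g, hg, rfl⟩ := (Set.mem_finsetSum _ _ _).1 ht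
    simp only [SetLike.mem_coe, LinearMap.mem_ker, ContinuousLinearMap.coe_coe, vsub_eq_sub,
      map_sub, map_sum]
    rw [sub_eq_zero]
    exact Finset.sum_congr rfl fun j hj =>
      apply_eq_of_mem_K (hf hj) (hg hj) fun h => hz (hT j hj z h)
  exact hle hw

theorem card_outer (hb : b < D.l) (hc : D.l < c) :
    (D.outer b c).card =
      ∑ m ∈ (Finset.range (D.k + 1)).filter (fun m => m < b ∨ c ≤ m), (D.i (m + 1) - D.i m - 1) := by
  have : D.outer b c = (Finset.filter (fun m : Fin (D.k + 1) => (m : ℕ) < b ∨ c ≤ (m : ℕ))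
      Finset.univ).sigma fun _ => Finset.univ := by
    ext j
    simp [outer]
  rw [this, Finset.card_sigma, Finset.sum_filter, Finset.sum_filter,
    Finset.sum_range (fun m => if m < b ∨ c ≤ m then D.i (m + 1) - D.i m - 1 else 0)]
  refine Finset.sum_congr rfl fun m _ => ?_
  split_ifs with h
  · rw [Finset.card_univ, Fintype.card_fin, mult, if_neg (by omega), Nat.sub_zero]
  · rfl

theorem two_le_card_extras (hσ : σ ∈ D.Neq) (hcrit : IsCritical D.collection)
    (hbc : D.IsLSplittingPair b c) (hsharp : ¬ D.IsSharpCriticalPair b c)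
    (hne : (D.outer b c).Nonempty) : 2 ≤ (D.extras σ b c).card := by
  classical
  have h1 := hcrit _ hne
  have h2 : dim (∑ j ∈ D.outer b c, D.collection j) ≠ (D.outer b c).card + 1 :=
    fun h => hsharp ⟨hbc, h⟩
  obtain ⟨⟨hlt, hck, -⟩, hb, hc⟩ := hbc
  set M := (Finset.range (D.k + 1)).filter (fun m => m < b ∨ c ≤ m) with hM
  have h3 : (D.slots D.i σ M).card ≤ (D.outer b c).card := by
    have := card_slots_le_sum (M := M) hσ
    rw [pos_i_l] at this
    rwa [card_outer hb hc]
  have h4 : dim (∑ j ∈ D.outer b c, D.collection j) ≤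
      (D.slots D.i σ M ∪ D.extras σ b c).card := by
    refine dim_sum_collection_le fun j hj z hz => ?_
    have hj' : (j.1 : ℕ) < b ∨ c ≤ (j.1 : ℕ) := by simpa [outer] using hj
    have hjk : (j.1 : ℕ) ≤ D.k := Nat.lt_succ_iff.1 j.1.2
    obtain ⟨m, hmk, h5, h6⟩ := exists_slot hσ z
    rw [pos_i_l] at h5 h6
    by_cases hm : m < b ∨ c ≤ m
    · refine Finset.mem_union_left _ (mem_slots.2 ⟨m, ?_, h5, h6⟩)
      simp only [hM, Finset.mem_filter, Finset.mem_range]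
      exact ⟨by omega, hm⟩
    · rw [not_or, not_lt, not_le] at hm
      refine Finset.mem_union_right _ (mem_extras.2 ⟨⟨?_, ?_⟩, ?_⟩)
      · exact (i_mono hm.1 (by omega)).trans_lt h5
      · exact h6.trans_le (i_mono hm.2 hck)
      · rintro ⟨h7, h8⟩
        rcases hj' with hj' | hj'
        · exact hz.2 ((D.chain_le hj' (by omega)).trans_lt h7)
        · exact hz.1 (h8.trans_le (D.chain_le hj' (by omega)))
  have h5 := Finset.card_union_le (D.slots D.i σ M) (D.extras σ b c)
  omega

end Extras


variable {P : Type*} [PartialOrder P] [Fintype P] {D : ChainData P}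

section Gaps

theorem exists_gap {M : Finset ℕ} {N t : ℕ} (hM : ∀ m ∈ M, m ≤ N) (ht : t ∉ M) (htN : t ≤ N) :
    ∃ b c, b ≤ t ∧ t < c ∧ c ≤ N + 1 ∧ (∀ m ∈ M, m < b ∨ c ≤ m) ∧ (b = 0 ∨ b - 1 ∈ M) ∧
      (c = N + 1 ∨ c ∈ M) := by
  have hb : ∀ n ≤ t, ∃ b ≤ n, (∀ m ∈ M, m < b ∨ n ≤ m) ∧ (b = 0 ∨ b - 1 ∈ M) := by
    intro n
    induction n with
    | zero => exact fun _ => ⟨0, le_rfl, fun m _ => Or.inr (Nat.zero_le m), Or.inl rfl⟩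
    | succ n ih =>
      intro hn
      by_cases h : n ∈ M
      · exact ⟨n + 1, le_rfl, fun m _ => by omega, Or.inr (by simpa using h)⟩
      · obtain ⟨b, hbn, h1, h2⟩ := ih (by omega)
        refine ⟨b, by omega, fun m hm => ?_, h2⟩
        have : m ≠ n := fun h' => h (h' ▸ hm)
        have := h1 m hm
        omega
  have hc : ∀ j, ∀ n, n + j = N + 1 →
      ∃ c, n ≤ c ∧ c ≤ N + 1 ∧ (∀ m ∈ M, m < n ∨ c ≤ m) ∧ (c = N + 1 ∨ c ∈ M) := by
    intro j
    induction j with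
    | zero => exact fun n hn => ⟨N + 1, by omega, le_rfl,
        fun m hm => Or.inl (by have := hM m hm; omega), Or.inl rfl⟩
    | succ j ih =>
      intro n hn
      by_cases h : n ∈ M
      · exact ⟨n, le_rfl, by omega, fun m _ => by omega, Or.inr h⟩
      · obtain ⟨c, h1, h2, h3, h4⟩ := ih (n + 1) (by omega)
        refine ⟨c, by omega, h2, fun m hm => ?_, h4⟩
        have : m ≠ n := fun h' => h (h' ▸ hm)
        have := h3 m hm
        omega
  obtain ⟨b, hb1, hb2, hb3⟩ := hb t le_rfl
  obtain ⟨c, hc1, hc2, hc3, hc4⟩ := hc (N - t) (t + 1) (by omega)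
  refine ⟨b, c, hb1, hc1, hc2, fun m hm => ?_, hb3, hc4⟩
  have : m ≠ t := fun h' => ht (h' ▸ hm)
  have := hb2 m hm
  have := hc3 m hm
  omega

theorem card_add_card_le {κ : Type*} {A E R X : Finset κ} (hA : ∀ z ∈ A, z ∉ X → z ∈ R)
    (hE : ∀ z ∈ E, z ∈ R) (hAE : Disjoint E A) : A.card + E.card ≤ R.card + X.card := by
  classical
  have h1 : A ∪ E ⊆ R ∪ (A ∩ X) := by
    intro z hz
    by_cases hzX : z ∈ A ∩ X
    · exact Finset.mem_union_right _ hzX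
    · refine Finset.mem_union_left _ ?_
      rcases Finset.mem_union.1 hz with h | h
      · exact hA z h fun h' => hzX (Finset.mem_inter.2 ⟨h, h'⟩)
      · exact hE z h
  have h2 := (Finset.card_le_card h1).trans (Finset.card_union_le _ _)
  have h3 := Finset.card_le_card (Finset.inter_subset_right : A ∩ X ⊆ X)
  rw [Finset.card_union_of_disjoint hAE.symm] at h2
  omega

theorem card_le_of_loss {σ : P → ℕ} (hσ : σ ∈ D.Neq) (hcrit : IsCritical D.collection)
    (hsplit : D.SplittingBound) {S : Finset D.Index} {X R : Finset D.Alpha} (hX : X.card ≤ 2)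
    (hR : ∀ z ∈ D.slots D.i σ (D.support S), z ∉ X → z ∈ R)
    (hE : ∀ y ∈ X, ∃ m₁ ∈ D.support S,
      (∀ m ∈ D.support S, ∀ b c z, (b < D.l ∧ D.l < c ∨ 2 ≤ X.card ∧ b ≤ D.l ∧ D.l ≤ c) →
        b ≤ D.k + 1 → c ≤ D.k + 1 → (m₁ < b ∨ c ≤ m₁) → D.i b < σ (D.val z) →
        σ (D.val z) < D.i c → (m + 1 = b ∨ m = c) → D.free m z → z ∈ R) ∧
      (2 ≤ X.card → ∀ b c, (m₁ < b ∨ c ≤ m₁) → ¬ D.IsSharpCriticalPair b c)) :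
    S.card ≤ R.card := by
  have hcount := card_add_le_card_slots_of_mem_Neq (S := S) hσ
  have hl := D.one_le_l
  have hlk := D.l_le_k
  rcases X.eq_empty_or_nonempty with rfl | ⟨y, hy⟩
  · have := card_add_card_le (E := ∅) hR (by simp) (Finset.disjoint_empty_left _)
    simp only [Finset.card_empty] at this
    omega
  obtain ⟨m₁, hm₁, hext, hsharp⟩ := hE y hy
  have hle : ∀ m ∈ D.support S, m ≤ D.k := fun m => le_k_of_mem_support
  have hm₁k := hle m₁ hm₁
  have key : ∀ t, t ≤ D.k → t ∉ D.support S → ∃ b c, b ≤ t ∧ t < c ∧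
      (∀ m ∈ D.support S, m < b ∨ c ≤ m) ∧ c ≤ D.k + 1 ∧ (c = D.k + 1 ∨ c ∈ D.support S) ∧
      (D.extras σ b c).Nonempty ∧
      ((b < D.l ∧ D.l < c ∨ 2 ≤ X.card ∧ b ≤ D.l ∧ D.l ≤ c) →
        (D.slots D.i σ (D.support S)).card + (D.extras σ b c).card ≤ R.card + X.card) := by
    intro t htk ht
    obtain ⟨b, c, h1, h2, h3, h4, h5, h6⟩ := exists_gap hle ht htk
    have hne : (b, c) ≠ (0, D.k + 1) := by
      rintro h
      simp only [Prod.mk.injEq] at h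
      have := h4 m₁ hm₁
      omega
    refine ⟨b, c, h1, h2, h4, h3, h6,
      extras_nonempty hσ hsplit ⟨by omega, h3, hne⟩, fun hbc => ?_⟩
    refine card_add_card_le hR (fun z hz => ?_) (disjoint_extras_slots hle (by omega) h3 h4)
    obtain ⟨m, hm, h7, h8⟩ := exists_free_of_mem_extras hσ (by omega) h3 h5 h6 hz
    have h9 := (mem_extras.1 hz).1
    exact hext m hm b c z hbc (by omega) h3 (h4 m₁ hm₁) h9.1 h9.2 h7 h8
  by_cases h0 : D.l - 1 ∈ D.support S
  · rw [if_pos h0] at hcount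
    by_cases h1 : D.l ∈ D.support S
    · have := card_add_card_le (E := ∅) hR (by simp) (Finset.disjoint_empty_left _)
      rw [if_pos h1] at hcount
      simp only [Finset.card_empty] at this
      omega
    · rcases Nat.lt_or_ge X.card 2 with hX2 | hX2
      · have := card_add_card_le (E := ∅) hR (by simp) (Finset.disjoint_empty_left _)
        simp only [Finset.card_empty] at this
        omega
      · obtain ⟨b, c, h2, h3, -, -, -, h4, h5⟩ := key D.l hlk h1
        have := h5 (Or.inr ⟨hX2, h2, h3.le⟩)
        have := h4.card_pos
        omega
  · obtain ⟨b, c, h2, h3, h4, h5, h6, h7, h8⟩ := key (D.l - 1) (by omega) h0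
    have h9 := h7.card_pos
    by_cases h1 : D.l ∈ D.support S
    · rw [if_pos h1] at hcount
      rcases Nat.lt_or_ge X.card 2 with hX2 | hX2
      · have := card_add_card_le (E := ∅) hR (by simp) (Finset.disjoint_empty_left _)
        simp only [Finset.card_empty] at this
        omega
      · have := h8 (Or.inr ⟨hX2, by omega, by omega⟩)
        omega
    · have hcl : D.l < c := by
        rcases h6 with h6 | h6
        · omega
        · have : c ≠ D.l := fun h => h1 (h ▸ h6)
          omega
      have h10 := h8 (Or.inl ⟨by omega, hcl⟩)
      rcases Nat.lt_or_ge X.card 2 with hX2 | hX2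
      · omega
      · have h11 := two_le_card_extras (b := b) (c := c) hσ hcrit ⟨⟨by omega, h5, ?_⟩, by omega, hcl⟩
          (hsharp hX2 b c (h4 m₁ hm₁)) ?_
        · omega
        · rintro h
          simp only [Prod.mk.injEq] at h
          have := h4 m₁ hm₁
          omega
        · obtain ⟨j, -, hj⟩ := mem_support.1 hm₁
          exact ⟨j, by simpa [outer, hj] using h4 m₁ hm₁⟩

end Gaps

section Extreme

theorem isExtremeNormalDirection_of_card_le {u : D.Space} (hu : ‖u‖ = 1)
    (hne : ∀ m ≤ D.k, (face (D.K m) u).Nonempty)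
    (h : ∀ S : Finset D.Index, ∃ R : Finset D.Alpha, S.card ≤ R.card ∧
      ∀ z ∈ R, ∃ m ∈ D.support S, ∃ w ∈ vectorSpan ℝ (face (D.K m) u),
        w z = 1 ∧ ∀ z' ∈ R, z' ≠ z → w z' = 0) :
    IsExtremeNormalDirection D.collection u := by
  refine ⟨hu, fun S => ?_⟩
  obtain ⟨R, hSR, hR⟩ := h S
  refine hSR.trans (card_le_finrank_of_dual _ R fun z hz => ?_)
  obtain ⟨m, hm, w, hw, hw'⟩ := hR z hz
  obtain ⟨j, hj, rfl⟩ := mem_support.1 hm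
  have hne' : ∀ i ∈ S, (face (D.collection i) u).Nonempty :=
    fun i _ => hne i.1 (Nat.lt_succ_iff.1 i.1.2)
  exact ⟨w, vectorSpan_le_vectorSpan_sum hj hne' hw, hw'⟩

variable (D) in
open scoped Classical in
/-- Elements `z` with `e_z` parallel to a face in direction `-e_y` of some `K_m`, `m ∈ M`. -/
noncomputable def negFree (M : Finset ℕ) (y : D.Alpha) : Finset D.Alpha :=
  Finset.univ.filter fun z => ∃ m ∈ M, D.free m z ∧
    (D.val z ≤ D.val y → D.chain (m + 1) < toExt (D.val y))

variable (D) in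
open scoped Classical in
/-- Elements `z` with `e_z` parallel to a face in direction `e_y` of some `K_m`, `m ∈ M`. -/
noncomputable def posFree (M : Finset ℕ) (y : D.Alpha) : Finset D.Alpha :=
  Finset.univ.filter fun z => ∃ m ∈ M, D.free m z ∧
    (D.val y ≤ D.val z → toExt (D.val y) < D.chain m)

variable (D) in
open scoped Classical in
/-- Elements `z ≠ v` with `e_z`, or `e_u + e_v` for `z = u`, parallel to a face in direction
`e_{uv}` of some `K_m`, `m ∈ M`. -/
noncomputable def pairFree (M : Finset ℕ) (u v : D.Alpha) : Finset D.Alpha :=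
  Finset.univ.filter fun z => z ≠ v ∧ ∃ m ∈ M, D.free m z ∧ (z = u ∧ D.free m v ∨ z ≠ u ∧
    (D.chain (m + 1) < toExt (D.val v) → ¬ D.val u ≤ D.val z) ∧
      (toExt (D.val u) < D.chain m → ¬ D.val z ≤ D.val v))

theorem mem_negFree {M : Finset ℕ} {y z : D.Alpha} : z ∈ D.negFree M y ↔ ∃ m ∈ M, D.free m z ∧
    (D.val z ≤ D.val y → D.chain (m + 1) < toExt (D.val y)) := by
  simp [negFree]

theorem mem_posFree {M : Finset ℕ} {y z : D.Alpha} : z ∈ D.posFree M y ↔ ∃ m ∈ M, D.free m z ∧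
    (D.val y ≤ D.val z → toExt (D.val y) < D.chain m) := by
  simp [posFree]

theorem mem_pairFree {M : Finset ℕ} {u v z : D.Alpha} : z ∈ D.pairFree M u v ↔
    z ≠ v ∧ ∃ m ∈ M, D.free m z ∧ (z = u ∧ D.free m v ∨ z ≠ u ∧
    (D.chain (m + 1) < toExt (D.val v) → ¬ D.val u ≤ D.val z) ∧
      (toExt (D.val u) < D.chain m → ¬ D.val z ≤ D.val v)) := by
  simp [pairFree]

theorem isExtremeNormalDirection_neg {y : D.Alpha}
    (h : ∀ S : Finset D.Index, S.card ≤ (D.negFree (D.support S) y).card) :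
    IsExtremeNormalDirection D.collection (-D.e y) := by
  refine isExtremeNormalDirection_of_card_le (by rw [norm_neg, norm_e])
    (fun m hm => face_neg_nonempty hm y) fun S => ⟨_, h S, fun z hz => ?_⟩
  obtain ⟨m, hm, h1, h2⟩ := mem_negFree.1 hz
  exact ⟨m, hm, D.e z, e_mem_vectorSpan_face_neg (le_k_of_mem_support hm) h1 h2,
    e_apply_self z, fun _ _ => e_apply_of_ne⟩

theorem isExtremeNormalDirection_pos {y : D.Alpha}
    (h : ∀ S : Finset D.Index, S.card ≤ (D.posFree (D.support S) y).card) :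
    IsExtremeNormalDirection D.collection (D.e y) := by
  refine isExtremeNormalDirection_of_card_le (norm_e y)
    (fun m hm => face_pos_nonempty hm y) fun S => ⟨_, h S, fun z hz => ?_⟩
  obtain ⟨m, hm, h1, h2⟩ := mem_posFree.1 hz
  exact ⟨m, hm, D.e z, e_mem_vectorSpan_face_pos (le_k_of_mem_support hm) h1 h2,
    e_apply_self z, fun _ _ => e_apply_of_ne⟩

theorem isExtremeNormalDirection_pair {u v : D.Alpha} (huv : D.val u < D.val v)
    (hbetween : ∀ z : D.Alpha, ¬ (D.val u < D.val z ∧ D.val z < D.val v))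
    (h : ∀ S : Finset D.Index, S.card ≤ (D.pairFree (D.support S) u v).card) :
    IsExtremeNormalDirection D.collection (D.e₂ u v) := by
  have hne : u ≠ v := fun h => huv.ne (congrArg D.val h)
  refine isExtremeNormalDirection_of_card_le (norm_e₂ hne)
    (fun m hm => face_pair_nonempty hm huv) fun S => ⟨_, h S, fun z hz => ?_⟩
  obtain ⟨hzv, m, hm, h1, ⟨rfl, h2⟩ | ⟨h2, h3, h4⟩⟩ := mem_pairFree.1 hz
  · refine ⟨m, hm, D.e z + D.e v,
      e_add_e_mem_vectorSpan_face_pair (le_k_of_mem_support hm) huv h1 h2 hbetween, ?_, ?_⟩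
    · rw [PiLp.add_apply, e_apply_self, e_apply_of_ne hzv, add_zero]
    · intro z' hz' hne'
      rw [PiLp.add_apply, e_apply_of_ne hne', e_apply_of_ne (mem_pairFree.1 hz').1, add_zero]
  · exact ⟨m, hm, D.e z, e_mem_vectorSpan_face_pair (le_k_of_mem_support hm) huv h1 h2 hzv
      (hbetween z) h3 h4, e_apply_self z, fun _ _ => e_apply_of_ne⟩

end Extreme

section Directions

variable {σ : P → ℕ}

theorem i_lt_apply (hσ : σ ∈ D.Neq) {m : ℕ} {z : P} (h : D.chain m < toExt z) :
    D.i m < σ z := by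
  have := pos_lt_apply hσ h
  rwa [pos_i_l] at this

theorem apply_lt_i (hσ : σ ∈ D.Neq) {m : ℕ} (hm : m ≤ D.k + 1) {z : P}
    (h : toExt z < D.chain m) : σ z < D.i m := by
  have := apply_lt_pos hσ hm h
  rwa [pos_i_l] at this

theorem apply_val_ne_i (hσ : σ ∈ D.Neq) {m : ℕ} (hm : m ≤ D.k + 1) (z : D.Alpha) :
    σ (D.val z) ≠ D.i m := by
  have := apply_val_ne_pos hσ hm z
  rwa [pos_i_l] at this

theorem free_of_i_lt (hσ : σ ∈ D.Neq) {m : ℕ} (hm : m ≤ D.k) {z : D.Alpha}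
    (h : D.i m < σ (D.val z)) (h' : σ (D.val z) < D.i (m + 1)) : D.free m z := by
  rw [← pos_i_l] at h h'
  exact free_of_slot hσ hm h h'

theorem lt_of_i_lt {a b : ℕ} (ha : a ≤ D.k + 1) (h : D.i a < D.i b) : a < b := by
  rw [← pos_i_l] at h
  exact lt_of_pos_lt D.admissible_i_l ha h

/-- The loss in direction `-e_y` if `y` has the first or the second position after `x_{m₀}`. -/
theorem card_le_card_negFree (hσ : σ ∈ D.Neq) (hcrit : IsCritical D.collection)
    (hsplit : D.SplittingBound) {m₀ d : ℕ} (hm₀ : m₀ ≤ D.l) {y : D.Alpha}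
    (hy : D.chain m₀ < toExt (D.val y)) (hyσ : σ (D.val y) = D.i m₀ + d) (hd : d ≤ 2)
    (hd2 : d = 2 → m₀ < D.l ∧ ∀ b c, m₀ < b → ¬ D.IsSharpCriticalPair b c)
    (S : Finset D.Index) : S.card ≤ (D.negFree (D.support S) y).card := by
  classical
  have hlk := D.l_le_k
  set X := (D.slots D.i σ (D.support S)).filter
    fun z => D.i m₀ < σ (D.val z) ∧ σ (D.val z) ≤ σ (D.val y) with hXdef
  have hXd : X.card ≤ d := by
    have := card_le_of_apply_mem_Ioc hσ (X := X) fun z hz => (Finset.mem_filter.1 hz).2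
    omega
  refine card_le_of_loss hσ hcrit hsplit (X := X) (by omega) ?_ ?_
  · intro z hz hzX
    obtain ⟨m, hm, h1, h2⟩ := mem_slots.1 hz
    have hmk := le_k_of_mem_support hm
    refine mem_negFree.2 ⟨m, hm, free_of_i_lt hσ hmk h1 h2, fun hzy => ?_⟩
    have h3 := hσ.1.2 _ _ hzy
    have h4 : σ (D.val z) ≤ D.i m₀ := by
      by_contra h4
      exact hzX (Finset.mem_filter.2 ⟨hz, by omega, h3⟩)
    exact (D.chain_le (lt_of_i_lt (D := D) (by omega) (h1.trans_le h4)) (by omega)).trans_lt hy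
  · intro x hx
    obtain ⟨hxs, h1, h2⟩ := Finset.mem_filter.1 hx
    obtain ⟨m₁, hm₁, h3, h4⟩ := mem_slots.1 hxs
    have hmk := le_k_of_mem_support hm₁
    have h5 : m₀ ≤ m₁ := Nat.lt_succ_iff.1 (lt_of_i_lt (D := D) (by omega) (h1.trans h4))
    have h6 : σ (D.val y) < D.i (m₁ + 1) := by
      have := apply_val_ne_i hσ (show m₁ + 1 ≤ D.k + 1 by omega) y
      omega
    have h7 : m₁ ≤ D.l ∧ (d = 2 → m₁ < D.l) := by
      have hyl : d = 2 → m₁ < D.l := by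
        intro hd'
        have hml := (hd2 hd').1
        refine lt_of_i_lt (D := D) (by omega) ?_
        have := i_mono (D := D) (show m₀ ≤ D.l - 1 by omega) (by omega)
        have := D.gap_left
        omega
      refine ⟨Nat.lt_succ_iff.1 (lt_of_i_lt (D := D) (by omega) (show D.i m₁ < D.i (D.l + 1) from ?_)), hyl⟩
      have := i_mono (D := D) hm₀ (by omega)
      have := D.gap_right
      rcases Nat.lt_or_ge d 2 with hd' | hd'
      · omega
      · have := i_strict (D := D) (hyl (by omega)) (by omega)
        omega
    have h8 : ∀ b c, (b < D.l ∧ D.l < c ∨ 2 ≤ X.card ∧ b ≤ D.l ∧ D.l ≤ c) →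
        (m₁ < b ∨ c ≤ m₁) → m₁ < b := by
      intro b c hbc hbc'
      omega
    refine ⟨m₁, hm₁, ?_, ?_⟩
    · intro m hm b c z hbc hbk hck hm₁bc h9 h10 hmbc hfree
      refine mem_negFree.2 ⟨m, hm, hfree, fun hzy => ?_⟩
      have := hσ.1.2 _ _ hzy
      have := i_mono (D := D) (show m₁ + 1 ≤ b from h8 b c hbc hm₁bc) hbk
      omega
    · intro hX2 b c hbc hsharp
      have hbl := hsharp.1.2
      exact (hd2 (by omega)).2 b c (h5.trans_lt (h8 b c (Or.inl hbl) hbc)) hsharp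

/-- The loss in direction `e_y` if `y` has the last or the last but one position before
`x_{m₀}`. -/
theorem card_le_card_posFree (hσ : σ ∈ D.Neq) (hcrit : IsCritical D.collection)
    (hsplit : D.SplittingBound) {m₀ d : ℕ} (hm₀ : D.l ≤ m₀) (hm₀k : m₀ ≤ D.k + 1) {y : D.Alpha}
    (hy : toExt (D.val y) < D.chain m₀) (hyσ : σ (D.val y) + d = D.i m₀) (hd : d ≤ 2)
    (hd2 : d = 2 → D.l < m₀ ∧ ∀ b c, c < m₀ → ¬ D.IsSharpCriticalPair b c)
    (S : Finset D.Index) : S.card ≤ (D.posFree (D.support S) y).card := by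
  classical
  have hlk := D.l_le_k
  have hl1 := D.one_le_l
  set X := (D.slots D.i σ (D.support S)).filter
    fun z => σ (D.val y) ≤ σ (D.val z) ∧ σ (D.val z) < D.i m₀ with hXdef
  have hy1 := one_le_apply hσ (D.val y)
  have hXd : X.card ≤ d := by
    have := card_le_of_apply_mem_Ioc hσ (X := X) (a := σ (D.val y) - 1) (b := D.i m₀ - 1)
      fun z hz => by have := (Finset.mem_filter.1 hz).2; omega
    omega
  refine card_le_of_loss hσ hcrit hsplit (X := X) (by omega) ?_ ?_
  · intro z hz hzX
    obtain ⟨m, hm, h1, h2⟩ := mem_slots.1 hz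
    have hmk := le_k_of_mem_support hm
    refine mem_posFree.2 ⟨m, hm, free_of_i_lt hσ hmk h1 h2, fun hzy => ?_⟩
    have h3 := hσ.1.2 _ _ hzy
    have h4 : D.i m₀ ≤ σ (D.val z) := by
      by_contra h4
      exact hzX (Finset.mem_filter.2 ⟨hz, h3, by omega⟩)
    have h5 := lt_of_i_lt (D := D) (by omega) (h4.trans_lt h2)
    exact hy.trans_le (D.chain_le (by omega) (by omega))
  · intro x hx
    obtain ⟨hxs, h1, h2⟩ := Finset.mem_filter.1 hx
    obtain ⟨m₁, hm₁, h3, h4⟩ := mem_slots.1 hxs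
    have hmk := le_k_of_mem_support hm₁
    have h5 : m₁ < m₀ := lt_of_i_lt (D := D) (by omega) (h3.trans h2)
    have h6 : D.i m₁ < σ (D.val y) := by
      have := apply_val_ne_i hσ (show m₁ ≤ D.k + 1 by omega) y
      omega
    have h7 : D.l ≤ m₁ + 1 ∧ (d = 2 → D.l ≤ m₁) := by
      have hyl : d = 2 → D.l ≤ m₁ := by
        intro hd'
        have hml := (hd2 hd').1
        refine Nat.lt_succ_iff.1 (lt_of_i_lt (D := D) (by omega) (show D.i D.l < D.i (m₁ + 1) from ?_))
        have := i_mono (D := D) (show D.l + 1 ≤ m₀ by omega) (by omega)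
        have := D.gap_right
        omega
      refine ⟨?_, hyl⟩
      rcases Nat.lt_or_ge d 2 with hd' | hd'
      · have h8 : D.l - 1 < m₁ + 1 := by
          refine lt_of_i_lt (D := D) (by omega) ?_
          have := i_mono (D := D) hm₀ (by omega)
          have := D.gap_left
          omega
        omega
      · have := hyl (by omega)
        omega
    have h8 : ∀ b c, (b < D.l ∧ D.l < c ∨ 2 ≤ X.card ∧ b ≤ D.l ∧ D.l ≤ c) →
        (m₁ < b ∨ c ≤ m₁) → c ≤ m₁ := by
      intro b c hbc hbc'
      omega
    refine ⟨m₁, hm₁, ?_, ?_⟩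
    · intro m hm b c z hbc hbk hck hm₁bc h9 h10 hmbc hfree
      refine mem_posFree.2 ⟨m, hm, hfree, fun hzy => ?_⟩
      have := hσ.1.2 _ _ hzy
      have := i_mono (D := D) (h8 b c hbc hm₁bc) (by omega)
      omega
    · intro hX2 b c hbc hsharp
      have hbl := hsharp.1.2
      exact (hd2 (by omega)).2 b c ((h8 b c (Or.inl hbl) hbc).trans_lt h5) hsharp

theorem card_le_card_pairFree_of_succ (hσ : σ ∈ D.Neq) (hcrit : IsCritical D.collection)
    (hsplit : D.SplittingBound) {u v : D.Alpha} (huv : σ (D.val u) + 1 = σ (D.val v))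
    (S : Finset D.Index) : S.card ≤ (D.pairFree (D.support S) u v).card := by
  classical
  have hne : ∀ {a b : D.Alpha}, a ≠ b → σ (D.val a) ≠ σ (D.val b) :=
    fun hab h => hab (val_injective (apply_injective hσ h))
  set X := (D.slots D.i σ (D.support S)).filter fun z => z = v with hXdef
  have hX1 : X.card ≤ 1 := by
    rw [← Finset.card_singleton v]
    exact Finset.card_le_card fun z hz => Finset.mem_singleton.2 (Finset.mem_filter.1 hz).2
  refine card_le_of_loss hσ hcrit hsplit (X := X) (by omega) ?_ ?_
  · intro z hz hzX
    have hzv : z ≠ v := fun h => hzX (Finset.mem_filter.2 ⟨hz, h⟩)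
    obtain ⟨m, hm, h1, h2⟩ := mem_slots.1 hz
    have hmk := le_k_of_mem_support hm
    refine mem_pairFree.2 ⟨hzv, m, hm, free_of_i_lt hσ hmk h1 h2, ?_⟩
    by_cases hzu : z = u
    · subst hzu
      refine Or.inl ⟨rfl, free_of_i_lt hσ hmk (by omega) ?_⟩
      have := apply_val_ne_i hσ (show m + 1 ≤ D.k + 1 by omega) v
      omega
    · refine Or.inr ⟨hzu, fun h3 h4 => ?_, fun h3 h4 => ?_⟩
      · have := i_lt_apply hσ h3
        have := hσ.1.2 _ _ h4
        have := hne hzu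
        omega
      · have := apply_lt_i hσ (by omega) h3
        have := hσ.1.2 _ _ h4
        omega
  · intro x hx
    obtain ⟨hxs, rfl⟩ := Finset.mem_filter.1 hx
    obtain ⟨m₁, hm₁, h3, h4⟩ := mem_slots.1 hxs
    have hmk := le_k_of_mem_support hm₁
    have h5 : D.i m₁ < σ (D.val u) := by
      have := apply_val_ne_i hσ (show m₁ ≤ D.k + 1 by omega) u
      omega
    refine ⟨m₁, hm₁, ?_, fun h => by omega⟩
    intro m hm b c z hbc hbk hck hm₁bc h9 h10 hmbc hfree
    have hmk' := le_k_of_mem_support hm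
    have hbc : b ≤ c := by omega
    rcases hm₁bc with h6 | h6
    · have h7 := i_mono (D := D) (show m₁ + 1 ≤ b from h6) hbk
      have h8 := i_mono (D := D) (show b ≤ m + 1 by omega) (by omega)
      refine mem_pairFree.2 ⟨?_, m, hm, hfree, Or.inr ⟨?_, fun h11 => ?_, fun _ h12 => ?_⟩⟩
      · rintro rfl; omega
      · rintro rfl; omega
      · have := i_lt_apply hσ h11
        omega
      · have := hσ.1.2 _ _ h12
        omega
    · have h7 := i_mono (D := D) h6 (by omega)
      have h8 := i_mono (D := D) (show m ≤ c by omega) hck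
      refine mem_pairFree.2 ⟨?_, m, hm, hfree, Or.inr ⟨?_, fun _ h12 => ?_, fun h11 => ?_⟩⟩
      · rintro rfl; omega
      · rintro rfl; omega
      · have := hσ.1.2 _ _ h12
        omega
      · have := apply_lt_i hσ (by omega) h11
        omega

theorem card_le_card_pairFree_of_i_l (hσ : σ ∈ D.Neq) {u v : D.Alpha}
    (hu : σ (D.val u) + 1 = D.i D.l) (hv : σ (D.val v) = D.i D.l + 1)
    (S : Finset D.Index) : S.card ≤ (D.pairFree (D.support S) u v).card := by
  classical
  have hlk := D.l_le_k
  have hl1 := D.one_le_l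
  have hcount := card_add_le_card_slots_of_mem_Neq (S := S) hσ
  have hne : ∀ {a b : D.Alpha}, a ≠ b → σ (D.val a) ≠ σ (D.val b) :=
    fun hab h => hab (val_injective (apply_injective hσ h))
  set X := (D.slots D.i σ (D.support S)).filter fun z => z = u ∨ z = v with hXdef
  have hX : X.card ≤ (if D.l - 1 ∈ D.support S then 1 else 0) +
      (if D.l ∈ D.support S then 1 else 0) := by
    have hsub : X ⊆ (if D.l - 1 ∈ D.support S then {u} else ∅) ∪
        (if D.l ∈ D.support S then {v} else ∅) := by
      intro z hz
      obtain ⟨hz, h⟩ := Finset.mem_filter.1 hz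
      obtain ⟨m, hm, h1, h2⟩ := mem_slots.1 hz
      have hmk := le_k_of_mem_support hm
      rcases h with rfl | rfl
      · have h3 : m < D.l := lt_of_i_lt (D := D) (by omega) (by omega)
        have h4 : D.l < m + 2 := by
          by_contra h4
          have := i_mono (D := D) (show m + 1 ≤ D.l - 1 by omega) (by omega)
          have := D.gap_left
          omega
        rw [if_pos (show D.l - 1 ∈ D.support S by rwa [show D.l - 1 = m by omega])]
        simp
      · have h3 : D.l < m + 1 := lt_of_i_lt (D := D) (by omega) (by omega)
        have h4 : m < D.l + 1 := lt_of_i_lt (D := D) (by omega) (by have := D.gap_right; omega)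
        rw [if_pos (show D.l ∈ D.support S by rwa [show D.l = m by omega])]
        simp
    refine ((Finset.card_le_card hsub).trans (Finset.card_union_le _ _)).trans (le_of_eq ?_)
    split_ifs <;> simp
  have hmain := card_add_card_le (A := D.slots D.i σ (D.support S)) (E := ∅) (X := X)
    (R := D.pairFree (D.support S) u v) ?_ (by simp) (Finset.disjoint_empty_left _)
  · rw [Finset.card_empty] at hmain
    omega
  intro z hz hzX
  have hzu : z ≠ u := fun h => hzX (Finset.mem_filter.2 ⟨hz, Or.inl h⟩)
  have hzv : z ≠ v := fun h => hzX (Finset.mem_filter.2 ⟨hz, Or.inr h⟩)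
  obtain ⟨m, hm, h1, h2⟩ := mem_slots.1 hz
  have hmk := le_k_of_mem_support hm
  refine mem_pairFree.2 ⟨hzv, m, hm, free_of_i_lt hσ hmk h1 h2,
    Or.inr ⟨hzu, fun h3 h4 => ?_, fun h3 h4 => ?_⟩⟩
  · have := i_lt_apply hσ h3
    have := hσ.1.2 _ _ h4
    have := hne hzu
    omega
  · have := apply_lt_i hσ (by omega) h3
    have := hσ.1.2 _ _ h4
    have := hne hzv
    omega

theorem card_le_card_negFree_of_mem_Nplus (hσ : σ ∈ D.Nplus) {y : D.Alpha}
    (hy : D.chain (D.l - 1) < toExt (D.val y)) (hyσ : σ (D.val y) = D.i (D.l - 1) + 2)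
    (S : Finset D.Index) : S.card ≤ (D.negFree (D.support S) y).card := by
  classical
  have hlk := D.l_le_k
  have hl1 := D.one_le_l
  have hp := D.admissible_i_l_add_one
  have hpl := D.pos_l (D.i D.l + 1)
  have hpl' : D.pos (D.i D.l + 1) (D.l - 1) = D.i (D.l - 1) := D.pos_of_ne (by omega)
  have hcount := card_add_le_card_slots_of_mem_Nplus (S := S) hσ
  set X := (D.slots (D.pos (D.i D.l + 1)) σ (D.support S)).filter
    fun z => D.i (D.l - 1) < σ (D.val z) ∧ σ (D.val z) ≤ σ (D.val y) with hXdef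
  have hX : X.card ≤ if D.l - 1 ∈ D.support S then 2 else 0 := by
    split_ifs with h
    · have := card_le_of_apply_mem_Ioc hσ (X := X) fun z hz => (Finset.mem_filter.1 hz).2
      omega
    · rw [Nat.le_zero, Finset.card_eq_zero, Finset.eq_empty_iff_forall_notMem]
      intro z hz
      obtain ⟨hz, h1, h2⟩ := Finset.mem_filter.1 hz
      obtain ⟨m, hm, h3, h4⟩ := mem_slots.1 hz
      have hmk := le_k_of_mem_support hm
      have hgap := D.gap_left
      have h5 := lt_of_pos_lt hp (a := m) (b := D.l) (by omega) (by omega)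
      have h6 := lt_of_pos_lt hp (a := D.l - 1) (b := m + 1) (by omega) (by omega)
      exact h (by rwa [show D.l - 1 = m by omega])
  have hmain := card_add_card_le (A := D.slots (D.pos (D.i D.l + 1)) σ (D.support S)) (E := ∅)
    (X := X) (R := D.negFree (D.support S) y) ?_ (by simp) (Finset.disjoint_empty_left _)
  · rw [Finset.card_empty] at hmain
    omega
  intro z hz hzX
  obtain ⟨m, hm, h1, h2⟩ := mem_slots.1 hz
  have hmk := le_k_of_mem_support hm
  refine mem_negFree.2 ⟨m, hm, free_of_slot hσ hmk h1 h2, fun hzy => ?_⟩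
  have h3 := hσ.1.2 _ _ hzy
  have h4 : σ (D.val z) ≤ D.i (D.l - 1) := by
    by_contra h4
    exact hzX (Finset.mem_filter.2 ⟨hz, by omega, h3⟩)
  have h5 := lt_of_pos_lt hp (a := m) (b := D.l - 1) (by omega) (by omega)
  exact (D.chain_le (show m + 1 ≤ D.l - 1 from h5) (by omega)).trans_lt hy

theorem card_le_card_posFree_of_mem_Nminus (hσ : σ ∈ D.Nminus) {y : D.Alpha}
    (hy : toExt (D.val y) < D.chain (D.l + 1)) (hyσ : σ (D.val y) + 2 = D.i (D.l + 1))
    (S : Finset D.Index) : S.card ≤ (D.posFree (D.support S) y).card := by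
  classical
  have hlk := D.l_le_k
  have hl1 := D.one_le_l
  have hp := D.admissible_i_l_sub_one
  have hpl := D.pos_l (D.i D.l - 1)
  have hpl' : D.pos (D.i D.l - 1) (D.l + 1) = D.i (D.l + 1) := D.pos_of_ne (by omega)
  have hcount := card_add_le_card_slots_of_mem_Nminus (S := S) hσ
  have hy1 := one_le_apply hσ (D.val y)
  set X := (D.slots (D.pos (D.i D.l - 1)) σ (D.support S)).filter
    fun z => σ (D.val y) ≤ σ (D.val z) ∧ σ (D.val z) < D.i (D.l + 1) with hXdef
  have hX : X.card ≤ if D.l ∈ D.support S then 2 else 0 := by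
    split_ifs with h
    · have := card_le_of_apply_mem_Ioc hσ (X := X) (a := σ (D.val y) - 1)
        (b := D.i (D.l + 1) - 1) fun z hz => by have := (Finset.mem_filter.1 hz).2; omega
      omega
    · rw [Nat.le_zero, Finset.card_eq_zero, Finset.eq_empty_iff_forall_notMem]
      intro z hz
      obtain ⟨hz, h1, h2⟩ := Finset.mem_filter.1 hz
      obtain ⟨m, hm, h3, h4⟩ := mem_slots.1 hz
      have hmk := le_k_of_mem_support hm
      have hgap := D.gap_right
      have hgap' := D.gap_left
      have h5 := lt_of_pos_lt hp (a := m) (b := D.l + 1) (by omega) (by omega)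
      have h6 := lt_of_pos_lt hp (a := D.l) (b := m + 1) (by omega) (by omega)
      exact h (by rwa [show D.l = m by omega])
  have hmain := card_add_card_le (A := D.slots (D.pos (D.i D.l - 1)) σ (D.support S)) (E := ∅)
    (X := X) (R := D.posFree (D.support S) y) ?_ (by simp) (Finset.disjoint_empty_left _)
  · rw [Finset.card_empty] at hmain
    omega
  intro z hz hzX
  obtain ⟨m, hm, h1, h2⟩ := mem_slots.1 hz
  have hmk := le_k_of_mem_support hm
  refine mem_posFree.2 ⟨m, hm, free_of_slot hσ hmk h1 h2, fun hzy => ?_⟩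
  have h3 := hσ.1.2 _ _ hzy
  have h4 : D.i (D.l + 1) ≤ σ (D.val z) := by
    by_contra h4
    exact hzX (Finset.mem_filter.2 ⟨hz, h3, by omega⟩)
  have h5 := lt_of_pos_lt hp (a := D.l + 1) (b := m + 1) (by omega) (by omega)
  exact hy.trans_le (D.chain_le (show D.l + 1 ≤ m by omega) (by omega))

end Directions

end ChainData
end Stanley
open Stanley ChainData in
theorem proposition7p2 {P : Type*} [PartialOrder P] [Fintype P] (D : Stanley.ChainData P)
    (hcrit : Stanley.IsCritical D.collection) (hsplit : D.SplittingBound) :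
    -- (a)
    (∀ m, m ≤ D.l → ∀ y : D.Alpha, D.chain m < Stanley.toExt (D.val y) →
      (∃ σ ∈ D.Neq, σ (D.val y) = D.i m + 1) →
        Stanley.IsExtremeNormalDirection D.collection (-D.e y)) ∧
    -- (b)
    (∀ m, D.l ≤ m → m ≤ D.k + 1 → ∀ y : D.Alpha, Stanley.toExt (D.val y) < D.chain m →
      (∃ σ ∈ D.Neq, σ (D.val y) + 1 = D.i m) →
        Stanley.IsExtremeNormalDirection D.collection (D.e y)) ∧
    -- (c)
    (∀ u v : D.Alpha, D.val u < D.val v →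
      (∃ σ ∈ D.Neq, σ (D.val u) + 1 = σ (D.val v)) →
        Stanley.IsExtremeNormalDirection D.collection (D.e₂ u v)) ∧
    -- (d)
    (∀ u v : D.Alpha, D.val u < D.val v →
      (∃ σ ∈ D.Neq, σ (D.val u) + 1 = D.i D.l ∧ σ (D.val v) = D.i D.l + 1) →
        Stanley.IsExtremeNormalDirection D.collection (D.e₂ u v)) ∧
    -- (e), where `a = r_max + 1`
    (∀ a s, D.IsMaximalSplittingPair a s → ∀ m, a ≤ m → m + 1 ≤ D.l →
      ∀ y : D.Alpha, D.chain m < Stanley.toExt (D.val y) →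
        (∃ σ ∈ D.Neq, σ (D.val y) = D.i m + 2) →
          Stanley.IsExtremeNormalDirection D.collection (-D.e y)) ∧
    -- (f), where `s = s_min`
    (∀ a s, D.IsMaximalSplittingPair a s → ∀ m, D.l + 1 ≤ m → m ≤ s →
      ∀ y : D.Alpha, Stanley.toExt (D.val y) < D.chain m →
        (∃ σ ∈ D.Neq, σ (D.val y) + 2 = D.i m) →
          Stanley.IsExtremeNormalDirection D.collection (D.e y)) ∧
    -- (g)
    (∀ y : D.Alpha, D.chain (D.l - 1) < Stanley.toExt (D.val y) →
      (∃ σ ∈ D.Nplus, σ (D.val y) = D.i (D.l - 1) + 2) →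
        Stanley.IsExtremeNormalDirection D.collection (-D.e y)) ∧
    -- (h)
    (∀ y : D.Alpha, Stanley.toExt (D.val y) < D.chain (D.l + 1) →
      (∃ σ ∈ D.Nminus, σ (D.val y) + 2 = D.i (D.l + 1)) →
        Stanley.IsExtremeNormalDirection D.collection (D.e y)) := by
  refine ⟨?_, ?_, ?_, ?_, ?_, ?_, ?_, ?_⟩
  · rintro m hm y hy ⟨σ, hσ, h⟩
    exact isExtremeNormalDirection_neg fun S =>
      card_le_card_negFree hσ hcrit hsplit hm hy h (by omega) (by omega) S
  · rintro m hm hmk y hy ⟨σ, hσ, h⟩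
    exact isExtremeNormalDirection_pos fun S =>
      card_le_card_posFree hσ hcrit hsplit hm hmk hy h (by omega) (by omega) S
  · rintro u v huv ⟨σ, hσ, h⟩
    refine isExtremeNormalDirection_pair huv (fun z hz => ?_) fun S =>
      card_le_card_pairFree_of_succ hσ hcrit hsplit h S
    have := apply_lt hσ hz.1
    have := apply_lt hσ hz.2
    omega
  · rintro u v huv ⟨σ, hσ, hu, hv⟩
    refine isExtremeNormalDirection_pair huv (fun z hz => ?_) fun S =>
      card_le_card_pairFree_of_i_l hσ hu hv S
    have := apply_lt hσ hz.1
    have := apply_lt hσ hz.2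
    have := apply_val_ne_i hσ (Nat.le_succ_of_le D.l_le_k) z
    omega
  · rintro a s ⟨ha, -⟩ m ham hml y hy ⟨σ, hσ, h⟩
    refine isExtremeNormalDirection_neg fun S =>
      card_le_card_negFree hσ hcrit hsplit (by omega) hy h le_rfl
        (fun _ => ⟨hml, fun b c hb hbc => ?_⟩) S
    have := ha.2 ⟨c, hbc⟩
    omega
  · rintro a s ⟨-, hs⟩ m hlm hms y hy ⟨σ, hσ, h⟩
    obtain ⟨a', hs'⟩ := hs.1
    have hsk := hs'.1.1.2.1
    refine isExtremeNormalDirection_pos fun S =>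
      card_le_card_posFree hσ hcrit hsplit (by omega) (by omega) hy h le_rfl
        (fun _ => ⟨hlm, fun b c hc hbc => ?_⟩) S
    have := hs.2 ⟨b, hbc⟩
    omega
  · rintro y hy ⟨σ, hσ, h⟩
    exact isExtremeNormalDirection_neg (card_le_card_negFree_of_mem_Nplus hσ hy h)
  · rintro y hy ⟨σ, hσ, h⟩
    exact isExtremeNormalDirection_pos (card_le_card_posFree_of_mem_Nminus hσ hy h)
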